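/- Let $m\ge 1$, $k\ge 0$ be integers, let $\mathbb{R}_m$ be the real Clifford algebra generated by $e_1,\dots,e_m$ with $e_j^2=-1$ and $e_ie_j=-e_je_i$ for $i\ne j$, and let $\partial_x=\sum_{j=1}^m e_j\partial_{x_j}$ be the Dirac operator. For $c\ge 0$ and $f\in C^2(B(1),\mathbb{R}_m)$, where $B(1)$ is the closed unit ball of $\mathbb{R}^m$ (regularity up to the boundary), put $$L_cf(x)=\partial_x\big((1-|x|^2)\,\partial_xf(x)\big)+4\pi^2c^2|x|^2f(x).$$ Let $Y_k\not\equiv 0$ be an $\mathbb{R}_m$-valued homogeneous polynomial of degree $k$ on $\mathbb{R}^m$ with $\partial_xY_k=0$. The even Clifford prolate spheroidal wave functions built on $Y_k$ are the nonzero eigenfunctions $\psi\in C^2(B(1),\mathbb{R}_m)$ of $L_c$ of the form $\psi(x)=P(|x|^2)Y_k(x)$ with $P$ real-valued. They are numbered $\psi_{0,m}^{k,c},\psi_{2,m}^{k,c},\psi_{4,m}^{k,c},\dots$ in increasing order of their eigenvalues; that is, for even $n$, $L_c\psi_{n,m}^{k,c}=\chi_{n,m}^{k,c}\psi_{n,m}^{k,c}$,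 where $\chi_{n,m}^{k,c}$ is the (real) eigenvalue of $L_c$ on functions of this form that has exactly $n/2$ distinct such eigenvalues below it. Then, for every $c>0$ and every even $n\ge 0$, the eigenvalue $\chi_{n,m}^{k,c}$ exists and satisfies $$n(n+2k+m)<\chi_{n,m}^{k,c}<n(n+2k+m)+8\pi^2c^2 .$$ -/

import Mathlib

/-- Euclidean space `ℝ^m`. -/
abbrev RSpace (m : ℕ) : Type := EuclideanSpace ℝ (Fin m)

/-- The negative definite quadratic form `x ↦ -|x|²` on `ℝ^m`. -/
noncomputable abbrev negSq (m : ℕ) : QuadraticForm ℝ (RSpace m) :=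
  -LinearMap.BilinMap.toQuadraticMap (innerₗ (RSpace m))

/-- The real Clifford algebra `ℝ_m`, with `e_j² = -1` and `e_i e_j = -e_j e_i` for `i ≠ j`. -/
abbrev Cl (m : ℕ) : Type := CliffordAlgebra (negSq m)

/-- The generator `e_j` of the Clifford algebra. -/
noncomputable def cliffordE {m : ℕ} (j : Fin m) : Cl m :=
  CliffordAlgebra.ι (negSq m) (EuclideanSpace.single j 1)

theorem cliffordE_mul_self {m : ℕ} (j : Fin m) : cliffordE j * cliffordE j = -1 := by
  simp [cliffordE, CliffordAlgebra.ι_sq_scalar]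

theorem cliffordE_anticomm {m : ℕ} {i j : Fin m} (h : i ≠ j) :
    cliffordE i * cliffordE j = -(cliffordE j * cliffordE i) := by
  rw [eq_neg_iff_add_eq_zero]
  simp [cliffordE, CliffordAlgebra.ι_mul_ι_add_swap, QuadraticMap.polar_neg,
    LinearMap.BilinMap.polar_toQuadraticMap, EuclideanSpace.inner_single_left, h, h.symm]

/-- The basis of the Clifford algebra indexed by the subsets `A` of `{1, …, m}`. -/
noncomputable def cliffordBasis (m : ℕ) : Module.Basis (Finset (Fin m)) ℝ (Cl m) :=
  ((EuclideanSpace.basisFun (Fin m) ℝ).toBasis.ExteriorAlgebra).map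
    (CliffordAlgebra.equivExterior (negSq m)).symm

/-- Coordinates in the basis, as a point of a Euclidean space. -/
noncomputable def cliffordCoord (m : ℕ) : Cl m ≃ₗ[ℝ] EuclideanSpace ℝ (Finset (Fin m)) :=
  (cliffordBasis m).equivFun.trans (WithLp.linearEquiv 2 ℝ (Finset (Fin m) → ℝ)).symm

/-- The norm `|λ|² = ∑_A |λ_A|²` on the Clifford algebra. -/
noncomputable instance cliffordNormedAddCommGroup (m : ℕ) : NormedAddCommGroup (Cl m) :=
  NormedAddCommGroup.induced (Cl m) (EuclideanSpace ℝ (Finset (Fin m)))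
    (cliffordCoord m).toLinearMap (cliffordCoord m).injective

noncomputable instance cliffordNormedSpace (m : ℕ) : NormedSpace ℝ (Cl m) :=
  NormedSpace.induced ℝ (Cl m) (EuclideanSpace ℝ (Finset (Fin m))) (cliffordCoord m).toLinearMap

/-- The (left) Dirac operator `∂_x f = ∑_j e_j ∂f/∂x_j`. -/
noncomputable def dirac {m : ℕ} (f : RSpace m → Cl m) (x : RSpace m) : Cl m :=
  ∑ j : Fin m, cliffordE j * fderiv ℝ f x (EuclideanSpace.single j 1)

/-- The Clifford differential operator
`L_c f (x) = ∂_x ((1 - |x|²) ∂_x f (x)) + 4 π² c² |x|² f (x)`. -/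
noncomputable def cliffordL {m : ℕ} (c : ℝ) (f : RSpace m → Cl m) (x : RSpace m) : Cl m :=
  dirac (fun y => (1 - ‖y‖ ^ 2) • dirac f y) x + (4 * Real.pi ^ 2 * c ^ 2 * ‖x‖ ^ 2) • f x

/-- `Y` is a homogeneous polynomial of degree `k` on `ℝ^m` with coefficients in the Clifford
algebra: a sum of terms `x^d a_d` over the multi-indices `d` with `|d| = k`. -/
def IsHomogeneousPoly {m : ℕ} (k : ℕ) (Y : RSpace m → Cl m) : Prop :=
  ∃ a : (Fin m → ℕ) → Cl m,
    ∀ x, Y x = ∑ d ∈ Finset.piAntidiag Finset.univ k, (∏ i, x i ^ d i) • a d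

/-- `Y ∈ M_l^+(k)`: `Y` is a left solid inner spherical monogenic of degree `k`, that is,
a left monogenic homogeneous polynomial of degree `k`. -/
def IsSphericalMonogenic {m : ℕ} (k : ℕ) (Y : RSpace m → Cl m) : Prop :=
  IsHomogeneousPoly k Y ∧ ∀ x, dirac Y x = 0

/-- `ψ` is an even Clifford prolate spheroidal wave function built on `Y`, with eigenvalue `χ`:
a nonzero function of the form `P(|x|²) Y(x)` which is `C²` on the closed unit ball
(up to the boundary) and satisfies `L_c ψ = χ ψ` in the ball. -/
structure IsEvenCPSWF {m : ℕ} (Y : RSpace m → Cl m) (c χ : ℝ) (ψ : RSpace m → Cl m) : Prop where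
  form : ∃ P : ℝ → ℝ, ∀ x ∈ Metric.closedBall (0 : RSpace m) 1, ψ x = P (‖x‖ ^ 2) • Y x
  smooth : ContDiffOn ℝ 2 ψ (Metric.closedBall 0 1)
  nonzero : ∃ x ∈ Metric.closedBall (0 : RSpace m) 1, ψ x ≠ 0
  eigen : ∀ x ∈ Metric.ball (0 : RSpace m) 1, cliffordL c ψ x = χ • ψ x

/-- The set of eigenvalues of `L_c` on the functions of the form `P(|x|²) Y(x)`. -/
def evenEigenvalues {m : ℕ} (Y : RSpace m → Cl m) (c : ℝ) : Set ℝ :=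
  {χ | ∃ ψ, IsEvenCPSWF Y c χ ψ}

/-- For even `n`, the eigenvalue `χ_n` of the `n`-th wave function `ψ_n` built on `Y`. The even
ones are `ψ_0, ψ_2, ψ_4, …`, in increasing order of their eigenvalues, so `χ_n` is the eigenvalue
which has exactly `n / 2` eigenvalues below it. -/
def IsCPSWFEigenvalue {m : ℕ} (Y : RSpace m → Cl m) (c : ℝ) (n : ℕ) (χ : ℝ) : Prop :=
  χ ∈ evenEigenvalues Y c ∧
    {χ' | χ' ∈ evenEigenvalues Y c ∧ χ' < χ}.encard = ((n / 2 : ℕ) : ℕ∞)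

/-!
In the variable `t = |x|²` the operator `L_c` acts on `P(|x|²) Y(x)`, with `Y` a spherical monogenic
of degree `k`, as a Jacobi operator plus `4π²c² t` acting on `P` (`cliffordL_radial`). Put
`b = k + m / 2`, `s = 1 - t` and `γ = 4π²c²`. The Jacobi polynomials `p_j(s) = ₂F₁(-j, j + b; 1; s)`
diagonalize the operator with `c = 0`, with eigenvalues `d_j = 4j(j + b)`, and multiplication by `s`
is tridiagonal on them. So `L_c` becomes the infinite tridiagonal matrix `D + γ (1 - s)` with
`D = diag(d_j)`, and `0 ≤ 1 - s ≤ 1` as quadratic forms, by explicit sums of squares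
(`jacobiDiff_energy`, `jacobiDiff_coenergy`).

The eigenvalues of `L_c` are exactly the `λ` for which the three-term recurrence of this matrix has
a nonzero solution decaying faster than every geometric sequence (`mem_evenEigenvalues_iff`).
Solutions of the recurrence either decay or grow superexponentially (`IsModeSeq.rapidDecay`). The
Jacobi coefficients of an eigenfunction grow at most geometrically, hence decay, and they do not all
vanish because polynomials are dense in the continuous functions. Conversely, the Jacobi series of a
decaying solution converges together with its derivatives, and its sum is not zero because the
Jacobi polynomials are orthogonal.

The min-max principle gives the bounds. If `N + 1` eigenvalues were at most `d_N`, some nonzero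
combination of their eigenvectors would have vanishing first `N` coordinates, and on such vectors
the form of `D + γ (1 - s)` exceeds `d_N` (`card_modes_le`). On the span of the first `N + 1` basis
vectors the form is at most `d_N + γ`, so every larger truncation of the matrix has `N + 1`
orthonormal eigenvectors with eigenvalues at most `d_N + γ`. Limits of these along an ultrafilter
give `N + 1` eigenvalues not exceeding `d_N + γ` (`exists_modes`). These two counts locate the
eigenvalue with exactly `N` eigenvalues below it in `(d_N, d_N + 2γ)`.
-/

open Polynomial Filter Topology

noncomputable section

/-! ### The Dirac operator on radial multiples of a spherical monogenic -/

instance cliffordFiniteDimensional (m : ℕ) : FiniteDimensional ℝ (Cl m) :=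
  Module.Finite.of_basis (cliffordBasis m)

/-- Multiplication in the Clifford algebra as a continuous bilinear map. -/
def cliffordMul (m : ℕ) : Cl m →L[ℝ] Cl m →L[ℝ] Cl m :=
  LinearMap.toContinuousLinearMap
    ((LinearMap.toContinuousLinearMap (𝕜 := ℝ) (E := Cl m) (F' := Cl m)).toLinearMap ∘ₗ
      LinearMap.mul ℝ (Cl m))

@[simp] theorem cliffordMul_apply {m : ℕ} (a b : Cl m) : cliffordMul m a b = a * b := rfl

/-- The inclusion of vectors in the Clifford algebra as a continuous linear map. -/
def cliffordVec (m : ℕ) : RSpace m →L[ℝ] Cl m :=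
  LinearMap.toContinuousLinearMap (CliffordAlgebra.ι (negSq m))

theorem cliffordVec_single {m : ℕ} (j : Fin m) :
    cliffordVec m (EuclideanSpace.single j 1) = cliffordE j := rfl

theorem cliffordVec_eq_sum {m : ℕ} (x : RSpace m) : cliffordVec m x = ∑ j, x j • cliffordE j := by
  conv_lhs => rw [← (EuclideanSpace.basisFun (Fin m) ℝ).sum_repr x]
  simp [map_sum, cliffordVec_single]

theorem cliffordVec_mul_self {m : ℕ} (x : RSpace m) :
    cliffordVec m x * cliffordVec m x = (-‖x‖ ^ 2) • (1 : Cl m) := by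
  have h := CliffordAlgebra.ι_sq_scalar (negSq m) x
  rw [show cliffordVec m x = CliffordAlgebra.ι (negSq m) x from rfl, h,
    Algebra.algebraMap_eq_smul_one]
  simp

theorem cliffordE_mul_vec {m : ℕ} (j : Fin m) (x : RSpace m) :
    cliffordE j * cliffordVec m x = -(cliffordVec m x * cliffordE j) - (2 * x j) • (1 : Cl m) := by
  have h := CliffordAlgebra.ι_mul_ι_add_swap (Q := negSq m) (EuclideanSpace.single j 1) x
  have h2 : QuadraticMap.polar (negSq m) (EuclideanSpace.single j 1) x = -(2 * x j) := by
    simp [QuadraticMap.polar_neg, LinearMap.BilinMap.polar_toQuadraticMap,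
      EuclideanSpace.inner_single_left, EuclideanSpace.inner_single_right]
    ring
  rw [h2, Algebra.algebraMap_eq_smul_one] at h
  have h3 : cliffordE j * cliffordVec m x + cliffordVec m x * cliffordE j
      = (-(2 * x j)) • (1 : Cl m) := h
  rw [neg_smul] at h3
  rw [eq_sub_iff_add_eq, ← sub_eq_zero]
  rw [← sub_eq_zero] at h3
  rw [← h3]; abel

section Homogeneous

variable {m k : ℕ} {Y : RSpace m → Cl m}

theorem IsHomogeneousPoly.contDiff (hY : IsHomogeneousPoly k Y) {N : WithTop ℕ∞} :
    ContDiff ℝ N Y := by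
  obtain ⟨a, ha⟩ := hY
  rw [show Y = fun x => _ from funext ha]
  refine ContDiff.sum fun d _ => ?_
  refine ContDiff.fun_smul (contDiff_prod fun i _ => ?_) contDiff_const
  exact ContDiff.pow (EuclideanSpace.proj (𝕜 := ℝ) i : RSpace m →L[ℝ] ℝ).contDiff _

theorem IsHomogeneousPoly.smul_apply (hY : IsHomogeneousPoly k Y) (r : ℝ) (x : RSpace m) :
    Y (r • x) = r ^ k • Y x := by
  obtain ⟨a, ha⟩ := hY
  rw [ha, ha, Finset.smul_sum]
  refine Finset.sum_congr rfl fun d hd => ?_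
  rw [smul_smul]
  congr 1
  rw [Finset.mem_piAntidiag] at hd
  simp only [PiLp.smul_apply, smul_eq_mul, mul_pow, Finset.prod_mul_distrib]
  rw [Finset.prod_pow_eq_pow_sum, hd.1]

/-- Euler's identity. -/
theorem IsHomogeneousPoly.fderiv_self (hY : IsHomogeneousPoly k Y) (x : RSpace m) :
    fderiv ℝ Y x x = (k : ℝ) • Y x := by
  have hd : HasFDerivAt Y (fderiv ℝ Y x) ((1 : ℝ) • x) := by
    rw [one_smul]
    exact ((hY.contDiff (N := 1)).differentiable (by simp) x).hasFDerivAt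
  have h1 : HasDerivAt (fun r : ℝ => Y (r • x)) (fderiv ℝ Y x ((1 : ℝ) • x)) 1 :=
    hd.comp_hasDerivAt (1 : ℝ) ((hasDerivAt_id (1 : ℝ)).smul_const x)
  have h2 : HasDerivAt (fun r : ℝ => Y (r • x)) (((k : ℝ) * 1 ^ (k - 1)) • Y x) 1 := by
    simp only [hY.smul_apply]
    exact (hasDerivAt_pow k (1 : ℝ)).smul_const (Y x)
  have := h1.unique h2
  simpa using this

theorem IsHomogeneousPoly.exists_unit (hm : 1 ≤ m) (hY : IsHomogeneousPoly k Y) (hY0 : Y ≠ 0) :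
    ∃ x₀ : RSpace m, ‖x₀‖ = 1 ∧ Y x₀ ≠ 0 := by
  obtain ⟨x, hx⟩ := Function.ne_iff.mp hY0
  by_cases h0 : x = 0
  · -- a homogeneous polynomial which does not vanish at the origin is constant
    have hk : k = 0 := by
      by_contra hk
      apply hx
      have := hY.smul_apply 0 x
      rw [zero_smul, zero_pow hk, zero_smul] at this
      rw [h0, this]; rfl
    refine ⟨EuclideanSpace.single ⟨0, hm⟩ 1, by simp, ?_⟩
    have := hY.smul_apply 0 (EuclideanSpace.single (⟨0, hm⟩ : Fin m) (1 : ℝ))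
    rw [hk, zero_smul, pow_zero, one_smul, ← h0] at this
    rw [← this]; exact hx
  · refine ⟨‖x‖⁻¹ • x, norm_smul_inv_norm (𝕜 := ℝ) h0, ?_⟩
    rw [hY.smul_apply]
    exact smul_ne_zero (pow_ne_zero _ (inv_ne_zero (norm_ne_zero_iff.mpr h0))) hx

end Homogeneous

theorem hasFDerivAt_comp_normSq {m : ℕ} {P : ℝ → ℝ} {P₁ : ℝ} {x : RSpace m}
    (hP : HasDerivAt P P₁ (‖x‖ ^ 2)) :
    HasFDerivAt (fun y : RSpace m => P (‖y‖ ^ 2)) (P₁ • (2 • innerSL ℝ x)) x :=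
  hP.comp_hasFDerivAt x (hasStrictFDerivAt_norm_sq x).hasFDerivAt

theorem inner_single_one {m : ℕ} (x : RSpace m) (j : Fin m) :
    inner ℝ x (EuclideanSpace.single j (1 : ℝ)) = x j := by
  simp [EuclideanSpace.inner_single_right]

/-- Product rule for a radial scalar factor. -/
theorem dirac_radial_smul {m : ℕ} {P : ℝ → ℝ} {P₁ : ℝ} {f : RSpace m → Cl m} {x : RSpace m}
    (hP : HasDerivAt P P₁ (‖x‖ ^ 2)) (hf : DifferentiableAt ℝ f x) :
    dirac (fun y => P (‖y‖ ^ 2) • f y) x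
      = P (‖x‖ ^ 2) • dirac f x + (2 * P₁) • (cliffordVec m x * f x) := by
  have h := (hasFDerivAt_comp_normSq hP).smul hf.hasFDerivAt
  unfold dirac
  rw [show (fun y => P (‖y‖ ^ 2) • f y) = (fun y : RSpace m => P (‖y‖ ^ 2)) • f from rfl,
    h.fderiv, cliffordVec_eq_sum, Finset.sum_mul, Finset.smul_sum, Finset.smul_sum, ← Finset.sum_add_distrib]
  refine Finset.sum_congr rfl fun j _ => ?_
  simp only [add_apply, smul_apply,
    ContinuousLinearMap.smulRight_apply, innerSL_apply_apply, inner_single_one, smul_eq_mul, mul_add,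
    mul_smul_comm, smul_mul_assoc, smul_smul, nsmul_eq_mul, Nat.cast_ofNat]
  congr 2
  ring

/-- `∂ₓ(x Y) = -(m + 2k) Y` for a spherical monogenic of degree `k`. -/
theorem dirac_vec_mul {m k : ℕ} {Y : RSpace m → Cl m} (hY : IsSphericalMonogenic k Y)
    (x : RSpace m) :
    dirac (fun y => cliffordVec m y * Y y) x = (-(2 * k + m : ℝ)) • Y x := by
  have hd : HasFDerivAt Y (fderiv ℝ Y x) x :=
    ((hY.1.contDiff (N := 1)).differentiable (by simp) x).hasFDerivAt
  have h := (cliffordMul m).hasFDerivAt_of_bilinear (cliffordVec m).hasFDerivAt hd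
  simp only [cliffordMul_apply] at h
  unfold dirac
  rw [h.fderiv]
  have hsum : ∀ j : Fin m, cliffordE j *
      (((cliffordMul m).precompR (RSpace m) (cliffordVec m x) (fderiv ℝ Y x) +
        (cliffordMul m).precompL (RSpace m) (cliffordVec m) (Y x)) (EuclideanSpace.single j 1))
      = -(cliffordVec m x * (cliffordE j * fderiv ℝ Y x (EuclideanSpace.single j 1)))
        - 2 • fderiv ℝ Y x (x j • EuclideanSpace.single j 1) - Y x := by
    intro j
    rw [add_apply, ContinuousLinearMap.precompR_apply, ContinuousLinearMap.precompL_apply,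
      ContinuousLinearMap.compL_apply, ContinuousLinearMap.comp_apply, cliffordMul_apply,
      cliffordMul_apply, cliffordVec_single, mul_add,
      ← mul_assoc (cliffordE j) (cliffordVec m x), cliffordE_mul_vec,
      ← mul_assoc (cliffordE j) (cliffordE j), cliffordE_mul_self]
    rw [sub_mul, neg_mul, map_smul, smul_mul_assoc, one_mul, neg_mul, one_mul, mul_assoc, mul_smul,
      ← sub_eq_add_neg, two_smul, two_smul]
  rw [Finset.sum_congr rfl fun j _ => hsum j, Finset.sum_sub_distrib, Finset.sum_sub_distrib,
    Finset.sum_neg_distrib, ← Finset.mul_sum]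
  have h0 : ∑ j : Fin m, cliffordE j * fderiv ℝ Y x (EuclideanSpace.single j 1) = 0 := hY.2 x
  have hx : ∑ j : Fin m, x j • EuclideanSpace.single j (1 : ℝ) = x := by
    conv_rhs => rw [← (EuclideanSpace.basisFun (Fin m) ℝ).sum_repr x]
    simp
  rw [h0, ← Finset.smul_sum, ← map_sum, hx, hY.1.fderiv_self]
  simp only [mul_zero, neg_zero, zero_sub, Finset.sum_const, Finset.card_univ, Fintype.card_fin]
  rw [neg_smul, add_smul, ← Nat.cast_smul_eq_nsmul ℝ, ← Nat.cast_smul_eq_nsmul ℝ, smul_smul]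
  push_cast
  abel

theorem dirac_congr {m : ℕ} {f g : RSpace m → Cl m} {x : RSpace m} (h : f =ᶠ[nhds x] g) :
    dirac f x = dirac g x := by
  unfold dirac; rw [h.fderiv_eq]

/-- In the variable `t = |x|²`, the operator `L_c` acts on `P(|x|²) Y(x)` as a Jacobi operator
plus `4π²c² t`. -/
theorem cliffordL_radial {m k : ℕ} {Y : RSpace m → Cl m} (hY : IsSphericalMonogenic k Y) (c : ℝ)
    {P P₁ : ℝ → ℝ} {P₂ : ℝ} {ψ : RSpace m → Cl m} {x : RSpace m}
    (hψ : ∀ᶠ y in nhds x, ψ y = P (‖y‖ ^ 2) • Y y)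
    (hP : ∀ᶠ y in nhds x, HasDerivAt P (P₁ (‖y‖ ^ 2)) (‖y‖ ^ 2))
    (hP₁ : HasDerivAt P₁ P₂ (‖x‖ ^ 2)) :
    cliffordL c ψ x =
      (-4 * ‖x‖ ^ 2 * ((1 - ‖x‖ ^ 2) * P₂ - P₁ (‖x‖ ^ 2))
        - 2 * (2 * k + m) * (1 - ‖x‖ ^ 2) * P₁ (‖x‖ ^ 2)
        + 4 * Real.pi ^ 2 * c ^ 2 * ‖x‖ ^ 2 * P (‖x‖ ^ 2)) • Y x := by
  have hYd : Differentiable ℝ Y := (hY.1.contDiff (N := 1)).differentiable (by simp)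
  have h1 : (fun y => (1 - ‖y‖ ^ 2) • dirac ψ y) =ᶠ[nhds x]
      fun y => (fun t => (1 - t) * (2 * P₁ t)) (‖y‖ ^ 2) • (cliffordVec m y * Y y) := by
    filter_upwards [hψ.eventually_nhds, hP] with y h1 h2
    rw [dirac_congr h1, dirac_radial_smul h2 (hYd y), hY.2, smul_zero, zero_add, smul_smul]
  have h2 : HasDerivAt (fun t => (1 - t) * (2 * P₁ t))
      (-1 * (2 * P₁ (‖x‖ ^ 2)) + (1 - ‖x‖ ^ 2) * (2 * P₂)) (‖x‖ ^ 2) :=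
    ((hasDerivAt_id _).const_sub 1).mul (hP₁.const_mul 2)
  have h3 : DifferentiableAt ℝ (fun y => cliffordVec m y * Y y) x :=
    ((cliffordMul m).hasFDerivAt_of_bilinear (cliffordVec m).hasFDerivAt
      (hYd x).hasFDerivAt).differentiableAt
  unfold cliffordL
  rw [dirac_congr h1, dirac_radial_smul h2 h3, dirac_vec_mul hY, hψ.self_of_nhds,
    ← mul_assoc (cliffordVec m x), cliffordVec_mul_self]
  simp only [smul_mul_assoc, one_mul, smul_smul, ← add_smul]
  congr 1
  ring

/-! ### Jacobi polynomials -/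

/-- The weights `2j + b`: up to a constant, the reciprocals of the squared norms of the Jacobi
polynomials. -/
def modeWeight (b : ℝ) (j : ℕ) : ℝ := 2 * j + b

/-- The off-diagonal coefficients of the Jacobi recurrence. The value at `0` is `0`, which makes
the truncated index `j - 1` below harmless. -/
def jacobiKappa (b : ℝ) (j : ℕ) : ℝ := j * (j - 1 + b) / (2 * j - 1 + b)

/-- The eigenvalues `4j(j + b)` of the operator with `c = 0`. -/
def freeEigenvalue (b : ℝ) (j : ℕ) : ℝ := 4 * j * (j + b)

/-- Multiplication by `s` in the (weighted) Jacobi basis, as a second order difference operator. -/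
def jacobiDiff (b : ℝ) (a : ℕ → ℝ) (j : ℕ) : ℝ :=
  jacobiKappa b j * (a j - a (j - 1)) - jacobiKappa b (j + 1) * (a (j + 1) - a j)

/-- The coefficient of `s ^ i` in the `j`-th Jacobi polynomial. -/
def jacobiCoeff (b : ℝ) (j : ℕ) : ℕ → ℝ
  | 0 => 1
  | i + 1 => ((i : ℝ) - j) * (i + j + b) / (i + 1) ^ 2 * jacobiCoeff b j i

/-- The shifted Jacobi polynomial `₂F₁(-j, j + b; 1; s)`. -/
def jacobiPoly (b : ℝ) (j : ℕ) : ℝ[X] :=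
  ∑ i ∈ Finset.range (j + 1), C (jacobiCoeff b j i) * X ^ i

theorem jacobiKappa_zero (b : ℝ) : jacobiKappa b 0 = 0 := by simp [jacobiKappa]

theorem jacobiKappa_succ (b : ℝ) (j : ℕ) :
    jacobiKappa b (j + 1) = (j + 1) * (j + b) / (2 * j + b + 1) := by
  simp only [jacobiKappa]; push_cast; congr 1 <;> ring

theorem jacobiKappa_succ_bounds {b : ℝ} (hb : 1 / 2 ≤ b) (j : ℕ) :
    ((j : ℝ) + 1) / 4 ≤ jacobiKappa b (j + 1) ∧ jacobiKappa b (j + 1) ≤ j + 1 := by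
  have hj : (0 : ℝ) ≤ j := j.cast_nonneg
  rw [jacobiKappa_succ, le_div_iff₀ (by linarith), div_le_iff₀ (by linarith)]
  constructor <;> nlinarith

theorem jacobiKappa_succ_pos {b : ℝ} (hb : 1 / 2 ≤ b) (j : ℕ) : 0 < jacobiKappa b (j + 1) :=
  lt_of_lt_of_le (by positivity) (jacobiKappa_succ_bounds hb j).1

theorem jacobiKappa_nonneg {b : ℝ} (hb : 1 / 2 ≤ b) (j : ℕ) : 0 ≤ jacobiKappa b j := by
  cases j with
  | zero => rw [jacobiKappa_zero]
  | succ j => exact (jacobiKappa_succ_pos hb j).le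

theorem jacobiKappa_le {b : ℝ} (hb : 1 / 2 ≤ b) (j : ℕ) : jacobiKappa b j ≤ j := by
  cases j with
  | zero => simp [jacobiKappa_zero]
  | succ j => exact_mod_cast (jacobiKappa_succ_bounds hb j).2

theorem modeWeight_pos {b : ℝ} (hb : 1 / 2 ≤ b) (j : ℕ) : 0 < modeWeight b j := by
  have hj : (0 : ℝ) ≤ j := j.cast_nonneg
  unfold modeWeight; linarith

theorem jacobiCoeff_eq_zero (b : ℝ) {j i : ℕ} (h : j < i) : jacobiCoeff b j i = 0 := by
  induction i, h using Nat.le_induction with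
  | base => simp [jacobiCoeff]
  | succ i _ ih => rw [jacobiCoeff, ih, mul_zero]

theorem jacobiPoly_coeff (b : ℝ) (j i : ℕ) : (jacobiPoly b j).coeff i = jacobiCoeff b j i := by
  simp only [jacobiPoly, finsetSum_coeff, coeff_C_mul, coeff_X_pow, mul_ite, mul_one, mul_zero,
    Finset.sum_ite_eq, Finset.mem_range, ite_eq_left_iff]
  intro h
  exact (jacobiCoeff_eq_zero b (by omega)).symm

/-- Contiguity of the coefficients in the degree. -/
theorem jacobiCoeff_succ_left (b : ℝ) (j i : ℕ) :
    ((j : ℝ) + 1 - i) * (j + b) * jacobiCoeff b (j + 1) i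
      = (j + 1) * (j + b + i) * jacobiCoeff b j i := by
  induction i with
  | zero => simp [jacobiCoeff]
  | succ i ih =>
    have h : ((i : ℝ) + 1) ^ 2 ≠ 0 := by positivity
    simp only [jacobiCoeff]
    push_cast
    field_simp
    linear_combination (-((j : ℝ) - i) * (i + j + 1 + b)) * ih

theorem jacobiKappa_mul_coeff_sub {b : ℝ} (hb : 1 / 2 ≤ b) (j i : ℕ) :
    jacobiKappa b (j + 1) * (jacobiCoeff b (j + 1) (i + 1) - jacobiCoeff b j (i + 1))
      = -((j + 1) * (i + j + b) / (i + 1)) * jacobiCoeff b j i ∧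
    jacobiKappa b (j + 1) * (jacobiCoeff b (j + 1) (i + 1) - jacobiCoeff b j (i + 1))
      = -((j + b) * (j + 1 - i) / (i + 1)) * jacobiCoeff b (j + 1) i := by
  have hj : (0 : ℝ) ≤ j := j.cast_nonneg
  have h1 : (2 * j + b + 1 : ℝ) ≠ 0 := by linarith
  have h2 : ((i : ℝ) + 1) ≠ 0 := by positivity
  have h3 : (j + b : ℝ) ≠ 0 := by linarith
  have ih := jacobiCoeff_succ_left b j i
  have key : jacobiKappa b (j + 1) * (jacobiCoeff b (j + 1) (i + 1) - jacobiCoeff b j (i + 1))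
      = -((j + 1) * (i + j + b) / (i + 1)) * jacobiCoeff b j i := by
    rw [jacobiKappa_succ]
    simp only [jacobiCoeff]
    push_cast
    field_simp
    linear_combination (-(i + j + 1 + b : ℝ)) * ih
  refine ⟨key, key.trans ?_⟩
  field_simp
  linear_combination ih

/-- The three-term recurrence, in the form of a second order difference equation. -/
theorem jacobiDiff_eval {b : ℝ} (hb : 1 / 2 ≤ b) (j : ℕ) :
    C (modeWeight b j) * (X * jacobiPoly b j)
      = C (jacobiKappa b j) * (jacobiPoly b j - jacobiPoly b (j - 1))
        - C (jacobiKappa b (j + 1)) * (jacobiPoly b (j + 1) - jacobiPoly b j) := by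
  ext i
  simp only [coeff_sub, coeff_C_mul, jacobiPoly_coeff]
  cases i with
  | zero => simp [jacobiCoeff]
  | succ i =>
    rw [coeff_X_mul, jacobiPoly_coeff, (jacobiKappa_mul_coeff_sub hb j i).1]
    have h2 : ((i : ℝ) + 1) ≠ 0 := by positivity
    cases j with
    | zero =>
      simp only [jacobiKappa_zero, modeWeight]
      cases i with
      | zero => simp
      | succ i => simp [jacobiCoeff_eq_zero b (Nat.succ_pos i)]
    | succ j =>
      rw [Nat.add_sub_cancel, (jacobiKappa_mul_coeff_sub hb j i).2, modeWeight]
      push_cast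
      field_simp
      ring

theorem jacobiDiff_eval' {b : ℝ} (hb : 1 / 2 ≤ b) (j : ℕ) (s : ℝ) :
    jacobiDiff b (fun i => (jacobiPoly b i).eval s) j
      = modeWeight b j * (s * (jacobiPoly b j).eval s) := by
  have := congrArg (eval s) (jacobiDiff_eval hb j)
  simp only [eval_mul, eval_C, eval_X, eval_sub] at this
  rw [this, jacobiDiff]

/-- The Jacobi differential equation. -/
theorem jacobiPoly_ode (b : ℝ) (j : ℕ) :
    C (4 * b) * (X * derivative (jacobiPoly b j))
      - C 4 * ((1 - X) * derivative (X * derivative (jacobiPoly b j)))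
      = C (freeEigenvalue b j) * jacobiPoly b j := by
  have h2 : ∀ i : ℕ, ((i : ℝ) + 1) ≠ 0 := fun i => by positivity
  rw [sub_mul, one_mul]
  ext i
  cases i with
  | zero =>
    simp [coeff_derivative, jacobiPoly_coeff, jacobiCoeff, freeEigenvalue]
    ring
  | succ i =>
    simp only [coeff_sub, coeff_C_mul, coeff_X_mul, coeff_derivative, jacobiPoly_coeff,
      freeEigenvalue]
    rw [jacobiCoeff.eq_def b j (i + 1 + 1)]
    have := h2 i
    have := h2 (i + 1)
    push_cast at *
    field_simp
    ring

/-- A geometric bound for the Jacobi polynomials and two derivatives near `[0, 1]`. -/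
theorem jacobiPoly_bound {b : ℝ} (hb : 1 / 2 ≤ b) :
    ∃ R : ℝ, 1 ≤ R ∧ ∀ j : ℕ, ∀ s : ℝ, |s| ≤ 2 →
      |(jacobiPoly b j).eval s| ≤ R ^ j ∧ |(derivative (jacobiPoly b j)).eval s| ≤ R ^ j ∧
        |(derivative (derivative (jacobiPoly b j))).eval s| ≤ R ^ j := by
  -- `R` sums the bounds for the coefficients of the recurrence solved for `p_{j+1}`:
  -- `κ_j / κ_{j+1} ≤ 4`, and `(2j + b) / κ_{j+1} ≤ 4(2 + b)`
  set R : ℝ := 9 + 16 * (2 + b) with hR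
  have hR1 : 1 ≤ R := by linarith
  refine ⟨R, hR1, ?_⟩
  -- one step of the recurrence, for any of the three families
  have step : ∀ (j : ℕ) (x y z u : ℝ), |x| ≤ R ^ (j - 1) → |y| ≤ R ^ j → |u| ≤ 4 * R ^ j →
      modeWeight b j * u = jacobiKappa b j * (y - x) - jacobiKappa b (j + 1) * (z - y) →
      |z| ≤ R ^ (j + 1) := by
    intro j x y z u hx hy hu h
    have hk := jacobiKappa_succ_bounds hb j
    have hk' := jacobiKappa_le hb j
    have hk0 := jacobiKappa_nonneg hb j
    have hw := modeWeight_pos hb j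
    have hj : (0 : ℝ) ≤ j := j.cast_nonneg
    have hp : (0 : ℝ) < R ^ j := by positivity
    have hx' : |x| ≤ R ^ j := hx.trans (pow_le_pow_right₀ hR1 (Nat.sub_le _ _))
    have hz : jacobiKappa b (j + 1) * z
        = jacobiKappa b (j + 1) * y + jacobiKappa b j * (y - x) - modeWeight b j * u := by
      linarith
    have hpos := jacobiKappa_succ_pos hb j
    have h1 : jacobiKappa b (j + 1) * |z| ≤ jacobiKappa b (j + 1) * R ^ j
        + jacobiKappa b j * (2 * R ^ j) + modeWeight b j * (4 * R ^ j) := by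
      rw [← abs_of_pos hpos, ← abs_mul, hz, abs_of_pos hpos]
      refine (abs_sub _ _).trans (add_le_add ((abs_add_le _ _).trans (add_le_add ?_ ?_)) ?_)
      · rw [abs_mul, abs_of_pos hpos]; gcongr
      · rw [abs_mul, abs_of_nonneg hk0]
        gcongr
        exact (abs_sub _ _).trans (by linarith)
      · rw [abs_mul, abs_of_pos hw]; gcongr
    have h2 : jacobiKappa b j ≤ 4 * jacobiKappa b (j + 1) := by linarith [hk.1]
    have h3 : modeWeight b j ≤ 4 * (2 + b) * jacobiKappa b (j + 1) := by
      have : (2 * j + b) ≤ (2 + b) * (j + 1) := by nlinarith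
      unfold modeWeight
      nlinarith [hk.1]
    have h4 : jacobiKappa b (j + 1) * |z| ≤ jacobiKappa b (j + 1) * R ^ (j + 1) := by
      refine h1.trans ?_
      rw [pow_succ]
      have := mul_le_mul_of_nonneg_right h2 hp.le
      have := mul_le_mul_of_nonneg_right h3 hp.le
      rw [hR]
      rw [hR] at *
      nlinarith
    exact le_of_mul_le_mul_left h4 hpos
  intro j
  suffices H : ∀ s : ℝ, |s| ≤ 2 →
      (|(jacobiPoly b j).eval s| ≤ R ^ j ∧ |(derivative (jacobiPoly b j)).eval s| ≤ R ^ j ∧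
        |(derivative (derivative (jacobiPoly b j))).eval s| ≤ R ^ j) ∧
      (|(jacobiPoly b (j - 1)).eval s| ≤ R ^ (j - 1) ∧
        |(derivative (jacobiPoly b (j - 1))).eval s| ≤ R ^ (j - 1) ∧
        |(derivative (derivative (jacobiPoly b (j - 1)))).eval s| ≤ R ^ (j - 1)) from
    fun s hs => (H s hs).1
  intro s hs
  induction j with
  | zero => simp [jacobiPoly, jacobiCoeff]
  | succ j ih =>
    obtain ⟨⟨h0, h1, h2⟩, h0', h1', h2'⟩ := ih
    have e := jacobiDiff_eval hb j
    have hp : (0 : ℝ) < R ^ j := by positivity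
    have e0 := congrArg (eval s) e
    have e1 := congrArg (eval s) (congrArg derivative e)
    have e2 := congrArg (eval s) (congrArg derivative (congrArg derivative e))
    simp only [derivative_mul, derivative_C, derivative_X, derivative_sub, zero_mul, zero_add,
      eval_mul, eval_C, eval_X, eval_sub, eval_add, one_mul, derivative_add] at e0 e1 e2
    have hs1 : ∀ y : ℝ, |y| ≤ R ^ j → |s * y| ≤ 2 * R ^ j := fun y hy => by
      rw [abs_mul]; gcongr
    refine ⟨⟨step j _ _ _ _ h0' h0 ?_ e0, step j _ _ _ _ h1' h1 ?_ e1,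
      step j _ _ _ _ h2' h2 ?_ e2⟩, h0, h1, h2⟩
    · linarith [hs1 _ h0]
    · refine (abs_add_le _ _).trans ?_
      linarith [hs1 _ h1]
    · refine (abs_add_le _ _).trans ?_
      have := abs_add_le (eval s (derivative (jacobiPoly b j)))
        (eval s (derivative (jacobiPoly b j))
          + s * eval s (derivative (derivative (jacobiPoly b j))))
      have h5 := abs_add_le (eval s (derivative (jacobiPoly b j)))
        (s * eval s (derivative (derivative (jacobiPoly b j))))
      linarith [hs1 _ h2]

/-! ### The recurrence for the Jacobi coefficients -/

/-- Decay faster than every geometric sequence. -/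
def RapidDecay (a : ℕ → ℝ) : Prop := ∀ ρ : ℝ, 0 < ρ → ∃ C, ∀ j, |a j| ≤ C * ρ ^ j

/-- Growth at most like some geometric sequence. -/
def GeomBounded (a : ℕ → ℝ) : Prop := ∃ C R : ℝ, 1 ≤ R ∧ ∀ j, |a j| ≤ C * R ^ j

theorem RapidDecay.geomBounded {a : ℕ → ℝ} (ha : RapidDecay a) : GeomBounded a := by
  obtain ⟨C, hC⟩ := ha 1 one_pos
  exact ⟨C, 1, le_rfl, hC⟩

theorem RapidDecay.mul_geomBounded {a y : ℕ → ℝ} (ha : RapidDecay a) (hy : GeomBounded y) :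
    RapidDecay fun j => a j * y j := by
  intro ρ hρ
  obtain ⟨D, R, hR, hD⟩ := hy
  obtain ⟨C, hC⟩ := ha (ρ / R) (by positivity)
  refine ⟨C * D, fun j => ?_⟩
  have h : C * (ρ / R) ^ j * (D * R ^ j) = C * D * ρ ^ j := by
    rw [div_pow]; field_simp
  rw [abs_mul, ← h]
  exact mul_le_mul (hC j) (hD j) (abs_nonneg _) ((abs_nonneg _).trans (hC j))

theorem RapidDecay.geomBounded_mul {a y : ℕ → ℝ} (ha : RapidDecay a) (hy : GeomBounded y) :
    RapidDecay fun j => y j * a j := by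
  simpa only [mul_comm] using ha.mul_geomBounded hy

theorem RapidDecay.summable {a : ℕ → ℝ} (ha : RapidDecay a) : Summable a := by
  obtain ⟨C, hC⟩ := ha (1 / 2) (by norm_num)
  exact Summable.of_norm_bounded
    ((summable_geometric_of_lt_one (by norm_num) (by norm_num)).mul_left C) hC

theorem RapidDecay.tendsto_zero {a : ℕ → ℝ} (ha : RapidDecay a) : Tendsto a atTop (𝓝 0) :=
  ha.summable.tendsto_atTop_zero

theorem RapidDecay.add {a y : ℕ → ℝ} (ha : RapidDecay a) (hy : RapidDecay y) :
    RapidDecay fun j => a j + y j := by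
  intro ρ hρ
  obtain ⟨C, hC⟩ := ha ρ hρ
  obtain ⟨D, hD⟩ := hy ρ hρ
  refine ⟨C + D, fun j => (abs_add_le _ _).trans ?_⟩
  rw [add_mul]
  exact add_le_add (hC j) (hD j)

theorem RapidDecay.const_mul {a : ℕ → ℝ} (ha : RapidDecay a) (c : ℝ) :
    RapidDecay fun j => c * a j := by
  intro ρ hρ
  obtain ⟨C, hC⟩ := ha ρ hρ
  refine ⟨|c| * C, fun j => ?_⟩
  rw [abs_mul, mul_assoc]
  exact mul_le_mul_of_nonneg_left (hC j) (abs_nonneg _)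

theorem RapidDecay.sum {ι : Type*} (s : Finset ι) {a : ι → ℕ → ℝ} (ha : ∀ i, RapidDecay (a i)) :
    RapidDecay fun j => ∑ i ∈ s, a i j := by
  classical
  induction s using Finset.induction_on with
  | empty => exact fun ρ _ => ⟨0, fun j => by simp⟩
  | insert i s hi ih => simpa only [Finset.sum_insert hi] using (ha i).add ih

theorem RapidDecay.shift {a : ℕ → ℝ} (ha : RapidDecay a) : RapidDecay fun j => a (j + 1) := by
  intro ρ hρ
  obtain ⟨C, hC⟩ := ha ρ hρ
  refine ⟨C * ρ, fun j => (hC (j + 1)).trans_eq ?_⟩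
  ring

theorem GeomBounded.shift {a : ℕ → ℝ} (ha : GeomBounded a) : GeomBounded fun j => a (j + 1) := by
  obtain ⟨C, R, hR, hC⟩ := ha
  refine ⟨C * R, R, hR, fun j => (hC (j + 1)).trans_eq ?_⟩
  ring

theorem geomBounded_of_abs_le {a : ℕ → ℝ} {C : ℝ} (hC : 0 ≤ C) (h : ∀ j, |a j| ≤ C * (j + 1)) :
    GeomBounded a := by
  refine ⟨C, 2, by norm_num, fun j => (h j).trans (mul_le_mul_of_nonneg_left ?_ hC)⟩
  exact_mod_cast Nat.lt_two_pow_self (n := j)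

theorem modeWeight_geomBounded {b : ℝ} (hb : 1 / 2 ≤ b) : GeomBounded (modeWeight b) := by
  refine geomBounded_of_abs_le (C := 2 + b) (by linarith) fun j => ?_
  rw [abs_of_pos (modeWeight_pos hb j), modeWeight]
  nlinarith [j.cast_nonneg (α := ℝ)]

theorem jacobiKappa_geomBounded {b : ℝ} (hb : 1 / 2 ≤ b) : GeomBounded (jacobiKappa b) := by
  refine geomBounded_of_abs_le (C := 1) (by linarith) fun j => ?_
  rw [abs_of_nonneg (jacobiKappa_nonneg hb j)]
  linarith [jacobiKappa_le hb j]

/-- The sequence `a` solves the eigenvalue equation `(D + γ (1 - s)) a = λ a` in the weighted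
Jacobi basis: it holds the Jacobi coefficients of a candidate for an eigenfunction. -/
def IsModeSeq (b g lam : ℝ) (a : ℕ → ℝ) : Prop :=
  ∀ j, modeWeight b j * (freeEigenvalue b j + g - lam) * a j = g * jacobiDiff b a j

theorem jacobiDiff_sum {ι : Type*} (b : ℝ) (s : Finset ι) (ξ : ι → ℝ) (a : ι → ℕ → ℝ) (j : ℕ) :
    jacobiDiff b (fun j => ∑ i ∈ s, ξ i * a i j) j = ∑ i ∈ s, ξ i * jacobiDiff b (a i) j := by
  simp only [jacobiDiff, ← Finset.sum_sub_distrib, Finset.mul_sum]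
  exact Finset.sum_congr rfl fun i _ => by ring

/-- A solution of the three-term recurrence is determined by its first term. -/
theorem IsModeSeq.eq_zero {b g lam : ℝ} {a : ℕ → ℝ} (hb : 1 / 2 ≤ b) (hg : 0 < g)
    (h : IsModeSeq b g lam a) (h0 : a 0 = 0) (j : ℕ) : a j = 0 := by
  suffices H : a j = 0 ∧ a (j - 1) = 0 from H.1
  induction j with
  | zero => simp [h0]
  | succ j ih =>
    refine ⟨?_, ih.1⟩
    have := h j
    rw [jacobiDiff, ih.1, ih.2] at this
    have h2 : g * (jacobiKappa b (j + 1) * a (j + 1)) = 0 := by linarith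
    simpa [hg.ne', (jacobiKappa_succ_pos hb j).ne'] using h2

theorem IsModeSeq.linear_comb {b g lam : ℝ} {a a' : ℕ → ℝ} (h : IsModeSeq b g lam a)
    (h' : IsModeSeq b g lam a') (x y : ℝ) : IsModeSeq b g lam fun j => x * a j + y * a' j := by
  intro j
  have h1 := h j
  have h2 := h' j
  simp only [jacobiDiff] at *
  linear_combination x * h1 + y * h2

/-- Where the diagonal of the recurrence is large, a solution grows by the factor `G`, up to the
contribution of the preceding term. -/
theorem IsModeSeq.growth {b g lam G : ℝ} {a : ℕ → ℝ} (hb : 1 / 2 ≤ b) (hg : 0 < g)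
    (h : IsModeSeq b g lam a) (hG : 0 ≤ G) (j : ℕ)
    (hj : g * (G + 5) ≤ freeEigenvalue b (j + 1) + g - lam) :
    G * |a (j + 1)| - 4 * |a j| ≤ |a (j + 2)| := by
  have hk := jacobiKappa_succ_bounds hb (j + 1)
  have hk1 := jacobiKappa_succ_bounds hb j
  have hpos := jacobiKappa_succ_pos hb (j + 1)
  have hpos1 := jacobiKappa_succ_pos hb j
  have hjn : (0 : ℝ) ≤ j := j.cast_nonneg
  push_cast at hk
  have e := h (j + 1)
  rw [jacobiDiff, Nat.add_sub_cancel] at e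
  set E := freeEigenvalue b (j + 1) + g - lam with hE
  set κ := jacobiKappa b (j + 1 + 1)
  set κ' := jacobiKappa b (j + 1)
  have hw : κ ≤ modeWeight b (j + 1) := by
    unfold modeWeight; push_cast; linarith
  have hκ : κ' ≤ 4 * κ := by linarith
  have hE0 : 0 ≤ E := le_trans (by positivity) hj
  have e2 : modeWeight b (j + 1) * E * a (j + 1)
      = g * κ' * a (j + 1) - g * κ' * a j + g * κ * a (j + 1) - g * κ * a (j + 2) := by
    rw [e]; ring
  have h1 : modeWeight b (j + 1) * E * |a (j + 1)|
      ≤ g * κ' * |a (j + 1)| + g * κ' * |a j| + g * κ * |a (j + 1)| + g * κ * |a (j + 2)| := by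
    have hwE : 0 ≤ modeWeight b (j + 1) * E := mul_nonneg (hpos.le.trans hw) hE0
    have hgk : 0 ≤ g * κ := by positivity
    have hgk' : 0 ≤ g * κ' := by positivity
    rw [← abs_of_nonneg hwE, ← abs_mul, e2]
    refine (abs_sub _ _).trans ?_
    rw [abs_mul (g * κ) (a (j + 2)), abs_of_nonneg hgk]
    refine add_le_add ((abs_add_le _ _).trans ?_) le_rfl
    rw [abs_mul (g * κ), abs_of_nonneg hgk]
    refine add_le_add ((abs_sub _ _).trans ?_) le_rfl
    rw [abs_mul (g * κ'), abs_mul (g * κ'), abs_of_nonneg hgk']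
  have h2 : κ * (g * (G + 5)) ≤ modeWeight b (j + 1) * E :=
    mul_le_mul hw hj (by positivity) (hpos.le.trans hw)
  have h3 := mul_le_mul_of_nonneg_right h2 (abs_nonneg (a (j + 1)))
  have h4 := mul_le_mul_of_nonneg_left
    (mul_le_mul_of_nonneg_right hκ (abs_nonneg (a (j + 1)))) hg.le
  have h5 := mul_le_mul_of_nonneg_left (mul_le_mul_of_nonneg_right hκ (abs_nonneg (a j))) hg.le
  refine le_of_mul_le_mul_left ?_ (mul_pos hg hpos)
  nlinarith

theorem freeEigenvalue_ge {b : ℝ} (hb : 1 / 2 ≤ b) (j : ℕ) : (j : ℝ) ^ 2 ≤ freeEigenvalue b j := by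
  unfold freeEigenvalue
  have := j.cast_nonneg (α := ℝ)
  nlinarith

theorem freeEigenvalue_strictMono {b : ℝ} (hb : 1 / 2 ≤ b) : StrictMono (freeEigenvalue b) := by
  refine strictMono_nat_of_lt_succ fun j => ?_
  unfold freeEigenvalue
  have := j.cast_nonneg (α := ℝ)
  push_cast
  nlinarith

/-- A solution of the recurrence either grows faster than every geometric sequence or decays
faster than every geometric sequence. -/
theorem IsModeSeq.rapidDecay {b g lam : ℝ} {a : ℕ → ℝ} (hb : 1 / 2 ≤ b) (hg : 0 < g)
    (h : IsModeSeq b g lam a) (ha : GeomBounded a) : RapidDecay a := by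
  obtain ⟨C, R, hR, hC⟩ := ha
  intro ρ hρ
  -- if `|a_{j+1}| > ρ |a_j|`, the growth factor `G` gives `|a_{j+2}| ≥ (2R + ρ) |a_{j+1}|`
  set G := 4 / ρ + 2 * R + ρ with hG
  have hG0 : 0 ≤ G := by positivity
  obtain ⟨J, hJ⟩ := exists_nat_ge (g * (G + 5) + lam)
  have hgr : ∀ j, J ≤ j → G * |a (j + 1)| - 4 * |a j| ≤ |a (j + 2)| := fun j hj => by
    refine h.growth hb hg hG0 j ?_
    have h1 := freeEigenvalue_ge hb (j + 1)
    have h2 : (J : ℝ) ≤ j := by exact_mod_cast hj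
    have h3 := j.cast_nonneg (α := ℝ)
    push_cast at h1
    nlinarith
  have hdec : ∀ j, J ≤ j → |a (j + 1)| ≤ ρ * |a j| := by
    intro j hj
    by_contra! hlt
    -- past `J`, a ratio exceeding `ρ` forces all further ratios to exceed `2R`
    have H : ∀ i, ρ * |a (j + i)| ≤ |a (j + i + 1)| ∧
        (2 * R) ^ i * |a (j + 1)| ≤ |a (j + i + 1)| := by
      intro i
      induction i with
      | zero => simpa using hlt.le
      | succ i ih =>
        have h1 := hgr (j + i) (by omega)
        have h2 : 4 * |a (j + i)| ≤ 4 / ρ * |a (j + i + 1)| := by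
          rw [div_mul_eq_mul_div, le_div_iff₀ hρ]
          linarith [ih.1]
        have h3 : (2 * R + ρ) * |a (j + i + 1)| ≤ |a (j + i + 2)| := by
          rw [hG] at h1; linarith
        have h4 := abs_nonneg (a (j + i + 1))
        refine ⟨?_, ?_⟩
        · change ρ * |a (j + i + 1)| ≤ |a (j + i + 2)|
          nlinarith
        · change (2 * R) ^ (i + 1) * |a (j + 1)| ≤ |a (j + i + 2)|
          have h5 := mul_le_mul_of_nonneg_left ih.2 (by linarith : 0 ≤ 2 * R)
          rw [pow_succ]
          nlinarith
    have hpos : 0 < |a (j + 1)| := lt_of_le_of_lt (by positivity) hlt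
    obtain ⟨i, hi⟩ := pow_unbounded_of_one_lt (C * R ^ (j + 1) / |a (j + 1)|) one_lt_two
    rw [div_lt_iff₀ hpos] at hi
    have h1 := (H i).2.trans (hC _)
    have hRi : 0 < R ^ i := by positivity
    rw [mul_pow, show j + i + 1 = (j + 1) + i by ring, pow_add R] at h1
    have h2 := mul_lt_mul_of_pos_right hi hRi
    linarith
  refine ⟨∑ i ∈ Finset.range (J + 1), |a i| / ρ ^ i, fun j => ?_⟩
  have hsmall : ∀ j, j ≤ J → |a j| ≤ (∑ i ∈ Finset.range (J + 1), |a i| / ρ ^ i) * ρ ^ j := by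
    intro j hj
    rw [← div_le_iff₀ (by positivity)]
    exact Finset.single_le_sum (f := fun i => |a i| / ρ ^ i) (fun i _ => by positivity)
      (Finset.mem_range.mpr (by omega))
  rcases le_total j J with hj | hj
  · exact hsmall j hj
  · induction j, hj using Nat.le_induction with
    | base => exact hsmall J le_rfl
    | succ j hj ih =>
      refine (hdec j hj).trans ?_
      rw [pow_succ]
      nlinarith [mul_le_mul_of_nonneg_left ih hρ.le]

/-- Summation by parts (the discrete Green identity). -/
theorem jacobiDiff_green (b : ℝ) (x y : ℕ → ℝ) (n : ℕ) :
    ∑ j ∈ Finset.range n, (x j * jacobiDiff b y j - y j * jacobiDiff b x j)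
      = jacobiKappa b n * (x n * y (n - 1) - y n * x (n - 1)) := by
  induction n with
  | zero => simp [jacobiKappa_zero]
  | succ n ih =>
    rw [Finset.sum_range_succ, ih, Nat.add_sub_cancel]
    simp only [jacobiDiff]
    ring

/-- Multiplication by `s` is nonnegative, up to a boundary term. -/
theorem jacobiDiff_energy (b : ℝ) (x : ℕ → ℝ) (n : ℕ) :
    ∑ j ∈ Finset.range n, x j * jacobiDiff b x j
      = ∑ j ∈ Finset.range n, jacobiKappa b (j + 1) * (x (j + 1) - x j) ^ 2
        - jacobiKappa b n * x n * (x n - x (n - 1)) := by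
  induction n with
  | zero => simp [jacobiKappa_zero]
  | succ n ih =>
    rw [Finset.sum_range_succ, ih, Finset.sum_range_succ, Nat.add_sub_cancel]
    simp only [jacobiDiff]
    ring

/-- Multiplication by `1 - s` is nonnegative, up to a boundary term: the squares come from the
solution `a_{j+1} / a_j = -(j + b) / (j + 1)` concentrated at `s = 1`. -/
theorem jacobiDiff_coenergy {b : ℝ} (hb : 1 / 2 ≤ b) (x : ℕ → ℝ) (n : ℕ) :
    ∑ j ∈ Finset.range n, x j * (modeWeight b j * x j - jacobiDiff b x j)
      = ∑ j ∈ Finset.range n, ((j + 1) * x (j + 1) + (j + b) * x j) ^ 2 / (2 * j + b + 1)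
        - ((n - jacobiKappa b n) * x n ^ 2 + jacobiKappa b n * x n * x (n - 1)) := by
  induction n with
  | zero => simp [jacobiKappa_zero]
  | succ n ih =>
    rw [Finset.sum_range_succ, ih, Finset.sum_range_succ, Nat.add_sub_cancel]
    have hsq : ((n + 1) * x (n + 1) + (n + b) * x n) ^ 2 / (2 * n + b + 1)
        = (n + 1 - jacobiKappa b (n + 1)) * x (n + 1) ^ 2
          + (n + b - jacobiKappa b (n + 1)) * x n ^ 2
          + 2 * jacobiKappa b (n + 1) * x n * x (n + 1) := by
      have h1 : (2 * n + b + 1 : ℝ) ≠ 0 := by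
        have hn := n.cast_nonneg (α := ℝ)
        linarith
      rw [jacobiKappa_succ]
      field_simp
      ring
    rw [hsq]
    simp only [jacobiDiff, modeWeight]
    push_cast
    ring

/-- The weighted inner product of sequences. It is meaningful only where the series converges, as it
does for rapidly decaying sequences (`seqInner_hasSum`). -/
def seqInner (b : ℝ) (x y : ℕ → ℝ) : ℝ := ∑' j, modeWeight b j * (x j * y j)

theorem seqInner_hasSum {b : ℝ} (hb : 1 / 2 ≤ b) {x y : ℕ → ℝ} (hx : RapidDecay x)
    (hy : RapidDecay y) : HasSum (fun j => modeWeight b j * (x j * y j)) (seqInner b x y) :=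
  ((hx.mul_geomBounded hy.geomBounded).geomBounded_mul (modeWeight_geomBounded hb)).summable.hasSum

theorem seqInner_self_pos {b : ℝ} (hb : 1 / 2 ≤ b) {x : ℕ → ℝ} (hx : RapidDecay x) (h0 : x ≠ 0) :
    0 < seqInner b x x := by
  obtain ⟨i, hi⟩ := Function.ne_iff.mp h0
  have hnn : ∀ j, 0 ≤ modeWeight b j * (x j * x j) := fun j =>
    mul_nonneg (modeWeight_pos hb j).le (mul_self_nonneg _)
  have h := (seqInner_hasSum hb hx hx)
  exact lt_of_lt_of_le (mul_pos (modeWeight_pos hb i) (mul_self_pos.mpr hi))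
    (h.summable.le_tsum i fun j _ => hnn j)

/-- The boundary terms of rapidly decaying sequences vanish in the limit. -/
theorem tendsto_kappa_mul {b : ℝ} (hb : 1 / 2 ≤ b) {x y : ℕ → ℝ} (hx : RapidDecay x)
    (hy : GeomBounded y) :
    Tendsto (fun n => jacobiKappa b (n + 1) * (x (n + 1) * y n)) atTop (𝓝 0) ∧
      Tendsto (fun n => jacobiKappa b (n + 1) * (x n * y (n + 1))) atTop (𝓝 0) :=
  ⟨((hx.shift.mul_geomBounded hy).geomBounded_mul (jacobiKappa_geomBounded hb).shift).tendsto_zero,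
    ((hx.mul_geomBounded hy.shift).geomBounded_mul (jacobiKappa_geomBounded hb).shift).tendsto_zero⟩

theorem IsModeSeq.orthogonal {b g lam lam' : ℝ} {a a' : ℕ → ℝ} (hb : 1 / 2 ≤ b)
    (h : IsModeSeq b g lam a) (h' : IsModeSeq b g lam' a') (ha : RapidDecay a)
    (ha' : RapidDecay a') (hne : lam ≠ lam') : seqInner b a a' = 0 := by
  have h1 : Tendsto (fun n => (lam - lam') *
      ∑ j ∈ Finset.range (n + 1), modeWeight b j * (a j * a' j)) atTop
      (𝓝 ((lam - lam') * seqInner b a a')) :=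
    (((seqInner_hasSum hb ha ha').tendsto_sum_nat.comp (tendsto_add_atTop_nat 1))).const_mul _
  have h2 : ∀ n, (lam - lam') * ∑ j ∈ Finset.range (n + 1), modeWeight b j * (a j * a' j)
      = g * (jacobiKappa b (n + 1) * (a (n + 1) * a' n)
        - jacobiKappa b (n + 1) * (a n * a' (n + 1))) := by
    intro n
    have := jacobiDiff_green b a a' (n + 1)
    rw [Nat.add_sub_cancel] at this
    rw [show g * (jacobiKappa b (n + 1) * (a (n + 1) * a' n)
        - jacobiKappa b (n + 1) * (a n * a' (n + 1)))
        = g * (jacobiKappa b (n + 1) * (a (n + 1) * a' n - a' (n + 1) * a n)) by ring,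
      ← this, Finset.mul_sum, Finset.mul_sum]
    refine Finset.sum_congr rfl fun j _ => ?_
    linear_combination a j * h' j - a' j * h j
  have ht := tendsto_kappa_mul hb ha ha'.geomBounded
  have h3 := (ht.1.sub ht.2).const_mul g
  simp only [sub_zero, mul_zero] at h3
  simp only [h2] at h1
  have := tendsto_nhds_unique h1 h3
  exact (mul_eq_zero.mp this).resolve_left (sub_ne_zero.mpr hne)

/-! ### At most `N` eigenvalues up to `d_N` -/

theorem seqInner_sum_left {b : ℝ} (hb : 1 / 2 ≤ b) {ι : Type*} (s : Finset ι) (ξ : ι → ℝ)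
    {a : ι → ℕ → ℝ} {y : ℕ → ℝ} (ha : ∀ i, RapidDecay (a i)) (hy : RapidDecay y) :
    seqInner b (fun j => ∑ i ∈ s, ξ i * a i j) y = ∑ i ∈ s, ξ i * seqInner b (a i) y := by
  have h := hasSum_sum (s := s) fun i _ => (seqInner_hasSum hb (ha i) hy).mul_left (ξ i)
  rw [← h.tsum_eq, seqInner]
  congr 1
  ext j
  rw [Finset.sum_mul, Finset.mul_sum]
  exact Finset.sum_congr rfl fun i _ => by ring

theorem seqInner_comm (b : ℝ) (x y : ℕ → ℝ) : seqInner b x y = seqInner b y x := by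
  simp only [seqInner, mul_comm (x _)]

/-- If `x` vanishes below `N` and its quadratic form satisfies `⟨(D + γ(1 - s))x, x⟩ ≤ d_N ⟨x, x⟩`,
then `x = 0`: on such sequences `D ≥ d_N`, with equality only for multiples of the `N`-th basis
vector, on which `1 - s` is positive. -/
theorem eq_zero_of_form_le {b g : ℝ} (hb : 1 / 2 ≤ b) (hg : 0 < g) {N : ℕ} {x y : ℕ → ℝ}
    (hx : RapidDecay x) (hy : RapidDecay y) (hN : ∀ j < N, x j = 0)
    (hxy : ∀ j, modeWeight b j * (freeEigenvalue b j + g) * x j - g * jacobiDiff b x j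
      = modeWeight b j * y j)
    (hle : seqInner b x y ≤ freeEigenvalue b N * seqInner b x x) : x = 0 := by
  set e : ℕ → ℝ := fun j => modeWeight b j * (freeEigenvalue b j - freeEigenvalue b N) * x j ^ 2
    + g * (((j + 1) * x (j + 1) + (j + b) * x j) ^ 2 / (2 * j + b + 1)) with he
  set B : ℕ → ℝ := fun n => g * ((((n + 1 : ℕ) : ℝ) - jacobiKappa b (n + 1)) * x (n + 1) ^ 2
    + jacobiKappa b (n + 1) * x (n + 1) * x n) with hB
  have hdN : ∀ j, 0 ≤ (freeEigenvalue b j - freeEigenvalue b N) * x j ^ 2 := by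
    intro j
    rcases lt_or_ge j N with hj | hj
    · simp [hN j hj]
    · exact mul_nonneg (sub_nonneg.mpr ((freeEigenvalue_strictMono hb).monotone hj)) (sq_nonneg _)
  have hden : ∀ j : ℕ, (0 : ℝ) < 2 * j + b + 1 := fun j => by
    have := j.cast_nonneg (α := ℝ); linarith
  have he0 : ∀ j, 0 ≤ e j := by
    intro j
    have h1 := mul_nonneg (modeWeight_pos hb j).le (hdN j)
    have h2 : 0 ≤ g * (((j + 1) * x (j + 1) + (j + b) * x j) ^ 2 / (2 * j + b + 1)) :=
      mul_nonneg hg.le (div_nonneg (sq_nonneg _) (hden j).le)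
    simp only [he]; linarith
  have hpart : ∀ n, ∑ j ∈ Finset.range (n + 1), e j
      = ∑ j ∈ Finset.range (n + 1), modeWeight b j * (x j * y j)
        - freeEigenvalue b N * ∑ j ∈ Finset.range (n + 1), modeWeight b j * (x j * x j) + B n := by
    intro n
    have h := jacobiDiff_coenergy hb x (n + 1)
    rw [Nat.add_sub_cancel] at h
    simp only [he, hB, Finset.sum_add_distrib, ← Finset.mul_sum]
    have h3 : ∑ j ∈ Finset.range (n + 1), modeWeight b j * (x j * y j)
        = ∑ j ∈ Finset.range (n + 1),
            modeWeight b j * (freeEigenvalue b j - freeEigenvalue b N) * x j ^ 2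
          + freeEigenvalue b N * ∑ j ∈ Finset.range (n + 1), modeWeight b j * (x j * x j)
          + g * ∑ j ∈ Finset.range (n + 1), x j * (modeWeight b j * x j - jacobiDiff b x j) := by
      rw [Finset.mul_sum, Finset.mul_sum, ← Finset.sum_add_distrib, ← Finset.sum_add_distrib]
      refine Finset.sum_congr rfl fun j _ => ?_
      linear_combination -x j * hxy j
    rw [h3, h]
    ring
  have hBlim : Tendsto B atTop (𝓝 0) := by
    have h1 : Tendsto (fun n => ((n + 1 : ℕ) : ℝ) * (x (n + 1) * x (n + 1))) atTop (𝓝 0) := by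
      have hn : GeomBounded fun n => (n : ℝ) :=
        geomBounded_of_abs_le zero_le_one fun j => by simp
      exact ((hx.mul_geomBounded hx.geomBounded).geomBounded_mul hn).shift.tendsto_zero
    have h2 : Tendsto (fun n => jacobiKappa b (n + 1) * (x (n + 1) * x (n + 1))) atTop (𝓝 0) :=
      ((hx.mul_geomBounded hx.geomBounded).geomBounded_mul
        (jacobiKappa_geomBounded hb)).shift.tendsto_zero
    have h := ((h1.sub h2).add (tendsto_kappa_mul hb hx hx.geomBounded).1).const_mul g
    simp only [sub_zero, add_zero, mul_zero] at h
    refine h.congr fun n => ?_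
    simp only [hB]; ring
  have hlim : Tendsto (fun n => ∑ j ∈ Finset.range (n + 1), e j) atTop
      (𝓝 (seqInner b x y - freeEigenvalue b N * seqInner b x x)) := by
    have h1 := (seqInner_hasSum hb hx hy).tendsto_sum_nat.comp (tendsto_add_atTop_nat 1)
    have h2 := (seqInner_hasSum hb hx hx).tendsto_sum_nat.comp (tendsto_add_atTop_nat 1)
    have := (h1.sub (h2.const_mul (freeEigenvalue b N))).add hBlim
    rw [add_zero] at this
    exact this.congr fun n => (hpart n).symm
  have hez : ∀ j, e j = 0 := by
    intro j
    refine le_antisymm ?_ (he0 j)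
    refine (ge_of_tendsto hlim (eventually_atTop.mpr ⟨j, fun n hn => ?_⟩)).trans (by linarith)
    exact Finset.single_le_sum (f := e) (fun i _ => he0 i) (Finset.mem_range.mpr (by omega))
  have hz : ∀ j, j ≠ N → x j = 0 := by
    intro j hj
    rcases lt_or_gt_of_ne hj with hj | hj
    · exact hN j hj
    · have h1 := hez j
      have h2 : 0 ≤ g * (((j + 1) * x (j + 1) + (j + b) * x j) ^ 2 / (2 * j + b + 1)) :=
        mul_nonneg hg.le (div_nonneg (sq_nonneg _) (hden j).le)
      have h3 : 0 < modeWeight b j * (freeEigenvalue b j - freeEigenvalue b N) :=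
        mul_pos (modeWeight_pos hb j) (sub_pos.mpr (freeEigenvalue_strictMono hb hj))
      simp only [he] at h1
      have h4 : modeWeight b j * (freeEigenvalue b j - freeEigenvalue b N) * x j ^ 2 ≤ 0 := by
        linarith
      have h5 : x j ^ 2 ≤ 0 := by
        by_contra! h
        linarith [mul_pos h3 h]
      exact pow_eq_zero_iff two_ne_zero |>.mp (le_antisymm h5 (sq_nonneg _))
  have hxN : x N = 0 := by
    have h1 := hez N
    simp only [he, sub_self, mul_zero, zero_mul, zero_add, hz (N + 1) (by omega)] at h1
    have hNb : (N + b : ℝ) ≠ 0 := by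
      have := N.cast_nonneg (α := ℝ); linarith
    simpa [hg.ne', (hden N).ne', hNb] using h1
  ext j
  by_cases hj : j = N
  · rw [hj, hxN]; rfl
  · exact hz j hj

/-- At most `N` eigenvalues do not exceed `d_N`. -/
theorem card_modes_le {b g : ℝ} (hb : 1 / 2 ≤ b) (hg : 0 < g) (N : ℕ) (s : Finset ℝ)
    (hs : ∀ lam ∈ s, lam ≤ freeEigenvalue b N ∧
      ∃ a : ℕ → ℝ, a ≠ 0 ∧ RapidDecay a ∧ IsModeSeq b g lam a) : s.card ≤ N := by
  by_contra! hcard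
  choose! a ha0 har ham using fun lam hlam => (hs lam hlam).2
  let v : s → Fin N → ℝ := fun lam j => a lam j
  have hdep : ¬ LinearIndependent ℝ v := fun h => by
    have := h.fintype_card_le_finrank
    simp at this
    omega
  -- a combination of eigenvectors whose first `N` coordinates vanish
  obtain ⟨ξ, hξ, i₀, hi₀⟩ := Fintype.not_linearIndependent_iff.mp hdep
  have har' : ∀ i : s, RapidDecay (a i) := fun i => har i i.2
  set x : ℕ → ℝ := fun j => ∑ i : s, ξ i * a i j with hx
  set y : ℕ → ℝ := fun j => ∑ i : s, (ξ i * i) * a i j with hy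
  have hxr : RapidDecay x := RapidDecay.sum _ fun i => (har' i).const_mul (ξ i)
  have hyr : RapidDecay y := RapidDecay.sum _ fun i => (har' i).const_mul (ξ i * i)
  have horth : ∀ i i' : s, i ≠ i' → seqInner b (a i) (a i') = 0 := fun i i' hne =>
    (ham i i.2).orthogonal hb (ham i' i'.2) (har' i) (har' i') (fun h => hne (Subtype.ext h))
  have hxa : ∀ i : s, seqInner b x (a i) = ξ i * seqInner b (a i) (a i) := by
    intro i
    rw [hx, seqInner_sum_left hb _ _ har' (har' i), Finset.sum_eq_single i]
    · intro i' _ hne; rw [horth i' i hne, mul_zero]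
    · simp
  have hx0 : x = 0 := by
    refine eq_zero_of_form_le hb hg (N := N) hxr hyr ?_ ?_ ?_
    · intro j hj
      have := congrFun hξ ⟨j, hj⟩
      simpa [v, hx] using this
    · intro j
      rw [hx, hy, jacobiDiff_sum, Finset.mul_sum, Finset.mul_sum, Finset.mul_sum,
        ← Finset.sum_sub_distrib]
      refine Finset.sum_congr rfl fun i _ => ?_
      linear_combination ξ i * ham i i.2 j
    · rw [seqInner_comm, hy, seqInner_sum_left hb _ _ har' hxr]
      conv_rhs => rw [hx, seqInner_sum_left hb _ _ har' hxr, Finset.mul_sum]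
      refine Finset.sum_le_sum fun i _ => ?_
      rw [seqInner_comm, hxa]
      have h1 : 0 ≤ ξ i ^ 2 * seqInner b (a i) (a i) :=
        mul_nonneg (sq_nonneg _) (seqInner_self_pos hb (har' i) (ha0 i i.2)).le
      have := mul_le_mul_of_nonneg_right (hs i i.2).1 h1
      linarith
  have h1 := hxa i₀
  rw [hx0] at h1
  have h2 : seqInner b 0 (a i₀) = 0 := by simp [seqInner]
  rw [h2] at h1
  exact mul_ne_zero hi₀ (seqInner_self_pos hb (har' i₀) (ha0 i₀ i₀.2)).ne' h1.symm

/-! ### Existence of eigenvalues -/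

/-- One half of the Courant–Fischer principle: a symmetric operator whose quadratic form is at most
`Λ` on a subspace of dimension `n` has `n` orthonormal eigenvectors with eigenvalues at
most `Λ`. -/
theorem LinearMap.IsSymmetric.exists_orthonormal_eigenvectors {E : Type*} [NormedAddCommGroup E]
    [InnerProductSpace ℝ E] [FiniteDimensional ℝ E] {T : E →ₗ[ℝ] E} (hT : T.IsSymmetric)
    {n : ℕ} {Λ : ℝ} (V : Submodule ℝ E) (hV : n ≤ Module.finrank ℝ V)
    (hle : ∀ v ∈ V, inner ℝ (T v) v ≤ Λ * ‖v‖ ^ 2) :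
    ∃ (f : Fin n → E) (μ : Fin n → ℝ), Orthonormal ℝ f ∧ (∀ i, T (f i) = μ i • f i) ∧
      ∀ i, μ i ≤ Λ := by
  classical
  set e := hT.eigenvectorBasis rfl with he
  set s : Finset (Fin (Module.finrank ℝ E)) :=
    Finset.univ.filter fun i => hT.eigenvalues rfl i ≤ Λ with hs
  have hcard : n ≤ s.card := by
    by_contra! hlt
    let F : V →ₗ[ℝ] (s → ℝ) := LinearMap.pi fun i => (innerₗ E (e i)).comp V.subtype
    have hF : ¬ Function.Injective F := fun h => by
      have := LinearMap.finrank_le_finrank_of_injective h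
      simp at this
      omega
    -- a vector of `V` orthogonal to all eigenvectors with small eigenvalue
    obtain ⟨v, hv, hv0⟩ : ∃ v, F v = 0 ∧ v ≠ 0 := by
      by_contra! h
      exact hF ((injective_iff_map_eq_zero F).mpr h)
    have hc : ∀ i ∈ s, inner ℝ (e i) (v : E) = 0 := fun i hi => congrFun hv ⟨i, hi⟩
    have h1 : inner ℝ (T v) (v : E)
        = ∑ i, hT.eigenvalues rfl i * inner ℝ (e i) (v : E) ^ 2 := by
      rw [← e.sum_inner_mul_inner]
      refine Finset.sum_congr rfl fun i _ => ?_
      rw [hT, he, hT.apply_eigenvectorBasis, inner_smul_right, real_inner_comm]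
      simp; ring
    have h2 : ‖(v : E)‖ ^ 2 = ∑ i, inner ℝ (e i) (v : E) ^ 2 := by
      rw [← real_inner_self_eq_norm_sq, ← e.sum_inner_mul_inner]
      refine Finset.sum_congr rfl fun i _ => ?_
      rw [real_inner_comm]; ring
    have h3 := hle v v.2
    rw [h1, h2, Finset.mul_sum] at h3
    have h4 : ∀ i ∈ Finset.univ, Λ * inner ℝ (e i) (v : E) ^ 2
        ≤ hT.eigenvalues rfl i * inner ℝ (e i) (v : E) ^ 2 := by
      intro i _
      by_cases hi : i ∈ s
      · rw [hc i hi]; simp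
      · have : Λ < hT.eigenvalues rfl i := by simpa [hs] using hi
        exact mul_le_mul_of_nonneg_right this.le (sq_nonneg _)
    have h5 := (Finset.sum_eq_sum_iff_of_le h4).mp (le_antisymm (Finset.sum_le_sum h4) h3)
    have h6 : ∀ i, inner ℝ (e i) (v : E) = 0 := by
      intro i
      by_cases hi : i ∈ s
      · exact hc i hi
      · have h7 : Λ < hT.eigenvalues rfl i := by simpa [hs] using hi
        have h8 := h5 i (Finset.mem_univ i)
        have h9 : (hT.eigenvalues rfl i - Λ) * inner ℝ (e i) (v : E) ^ 2 = 0 := by linarith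
        exact pow_eq_zero_iff two_ne_zero |>.mp
          ((mul_eq_zero.mp h9).resolve_left (sub_pos.mpr h7).ne')
    have h10 : ‖(v : E)‖ ^ 2 = 0 := by rw [h2]; simp [h6]
    exact hv0 (Subtype.ext (norm_eq_zero.mp (pow_eq_zero_iff two_ne_zero |>.mp h10)))
  obtain ⟨t, hts, htc⟩ := Finset.exists_subset_card_eq hcard
  let σ : Fin n → Fin (Module.finrank ℝ E) := fun i => (t.equivFin.symm (Fin.cast htc.symm i)).1
  have hσ : Function.Injective σ := fun i j h => by
    simpa [σ, Subtype.val_inj] using h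
  refine ⟨e ∘ σ, hT.eigenvalues rfl ∘ σ, e.orthonormal.comp σ hσ, fun i => ?_, fun i => ?_⟩
  · simp [he, hT.apply_eigenvectorBasis]
  · exact (Finset.mem_filter.mp (hts (t.equivFin.symm (Fin.cast htc.symm i)).2)).2

/-- The sequence of Jacobi coefficients of a vector in orthonormal coordinates, extended by zero. -/
def truncSeq (b : ℝ) (M : ℕ) : EuclideanSpace ℝ (Fin M) →ₗ[ℝ] (ℕ → ℝ) where
  toFun v j := if h : j < M then v ⟨j, h⟩ / √(modeWeight b j) else 0
  map_add' v w := by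
    ext j
    by_cases h : j < M
    · simp [h, add_div]
    · simp [h]
  map_smul' r v := by
    ext j
    by_cases h : j < M
    · simp [h, mul_div_assoc]
    · simp [h]

theorem truncSeq_of_le {b : ℝ} {M j : ℕ} (v : EuclideanSpace ℝ (Fin M)) (h : M ≤ j) :
    truncSeq b M v j = 0 := by
  simp [truncSeq, h.not_gt]

theorem truncSeq_apply {b : ℝ} {M : ℕ} (v : EuclideanSpace ℝ (Fin M)) (j : Fin M) :
    truncSeq b M v j = v j / √(modeWeight b j) := by
  simp [truncSeq]

theorem inner_eq_truncSeq {b : ℝ} (hb : 1 / 2 ≤ b) {M : ℕ} (v w : EuclideanSpace ℝ (Fin M)) :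
    inner ℝ v w = ∑ j ∈ Finset.range M, modeWeight b j * (truncSeq b M v j * truncSeq b M w j) := by
  rw [Finset.sum_range, PiLp.inner_apply]
  refine Finset.sum_congr rfl fun j _ => ?_
  rw [truncSeq_apply, truncSeq_apply]
  have h := modeWeight_pos hb j
  have h2 := Real.sq_sqrt h.le
  have h3 := (Real.sqrt_pos.mpr h).ne'
  field_simp
  rw [h2]
  simp
  ring

/-- The truncation of the operator `D + γ (1 - s)` to the first `M` Jacobi polynomials, in
orthonormal coordinates. -/
def truncOp (b g : ℝ) (M : ℕ) : EuclideanSpace ℝ (Fin M) →ₗ[ℝ] EuclideanSpace ℝ (Fin M) where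
  toFun v := WithLp.toLp 2 fun j =>
    (modeWeight b j * (freeEigenvalue b j + g) * truncSeq b M v j
      - g * jacobiDiff b (truncSeq b M v) j) / √(modeWeight b j)
  map_add' v w := by
    ext j
    simp only [map_add, Pi.add_apply, jacobiDiff, PiLp.add_apply]
    ring
  map_smul' r v := by
    ext j
    simp only [map_smul, Pi.smul_apply, jacobiDiff, PiLp.smul_apply, smul_eq_mul, RingHom.id_apply]
    ring

theorem truncSeq_truncOp {b g : ℝ} (hb : 1 / 2 ≤ b) {M : ℕ} (v : EuclideanSpace ℝ (Fin M)) {j : ℕ}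
    (hj : j < M) :
    modeWeight b j * truncSeq b M (truncOp b g M v) j
      = modeWeight b j * (freeEigenvalue b j + g) * truncSeq b M v j
        - g * jacobiDiff b (truncSeq b M v) j := by
  have h := truncSeq_apply (b := b) (truncOp b g M v) ⟨j, hj⟩
  rw [h]
  simp only [truncOp, LinearMap.coe_mk, AddHom.coe_mk]
  have h := modeWeight_pos hb j
  rw [div_div, Real.mul_self_sqrt h.le, mul_div_cancel₀ _ h.ne']

theorem inner_truncOp {b g : ℝ} (hb : 1 / 2 ≤ b) {M : ℕ} (v w : EuclideanSpace ℝ (Fin M)) :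
    inner ℝ (truncOp b g M v) w = ∑ j ∈ Finset.range M, truncSeq b M w j *
      (modeWeight b j * (freeEigenvalue b j + g) * truncSeq b M v j
        - g * jacobiDiff b (truncSeq b M v) j) := by
  rw [inner_eq_truncSeq hb]
  refine Finset.sum_congr rfl fun j hj => ?_
  rw [← truncSeq_truncOp hb v (Finset.mem_range.mp hj)]
  ring

theorem truncOp_isSymmetric {b : ℝ} (hb : 1 / 2 ≤ b) (g : ℝ) (M : ℕ) :
    (truncOp b g M).IsSymmetric := by
  intro v w
  rw [real_inner_comm _ v, inner_truncOp hb, inner_truncOp hb, ← sub_eq_zero,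
    ← Finset.sum_sub_distrib]
  have h := jacobiDiff_green b (truncSeq b M v) (truncSeq b M w) M
  rw [truncSeq_of_le v le_rfl, truncSeq_of_le w le_rfl] at h
  simp only [zero_mul, sub_zero, mul_zero] at h
  rw [← mul_zero g, ← h, Finset.mul_sum]
  refine Finset.sum_congr rfl fun j _ => ?_
  ring

theorem le_inner_truncOp {b g : ℝ} (hb : 1 / 2 ≤ b) (hg : 0 < g) {M : ℕ}
    (v : EuclideanSpace ℝ (Fin M)) :
    ∑ j ∈ Finset.range M, modeWeight b j * freeEigenvalue b j * truncSeq b M v j ^ 2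
      ≤ inner ℝ (truncOp b g M v) v := by
  have h := jacobiDiff_coenergy hb (truncSeq b M v) M
  rw [truncSeq_of_le v le_rfl] at h
  have hnn : 0 ≤ ∑ j ∈ Finset.range M, ((j + 1) * truncSeq b M v (j + 1)
      + (j + b) * truncSeq b M v j) ^ 2 / (2 * j + b + 1) := by
    refine Finset.sum_nonneg fun j _ => div_nonneg (sq_nonneg _) ?_
    have := j.cast_nonneg (α := ℝ); linarith
  have h2 : inner ℝ (truncOp b g M v) v
      = ∑ j ∈ Finset.range M, modeWeight b j * freeEigenvalue b j * truncSeq b M v j ^ 2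
        + g * ∑ j ∈ Finset.range M, truncSeq b M v j *
          (modeWeight b j * truncSeq b M v j - jacobiDiff b (truncSeq b M v) j) := by
    rw [inner_truncOp hb, Finset.mul_sum, ← Finset.sum_add_distrib]
    exact Finset.sum_congr rfl fun j _ => by ring
  rw [h2, h]
  have := mul_nonneg hg.le hnn
  linarith

theorem inner_truncOp_le {b g : ℝ} (hb : 1 / 2 ≤ b) (hg : 0 < g) {M : ℕ}
    (v : EuclideanSpace ℝ (Fin M)) :
    inner ℝ (truncOp b g M v) v
      ≤ ∑ j ∈ Finset.range M, modeWeight b j * (freeEigenvalue b j + g) * truncSeq b M v j ^ 2 := by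
  have h := jacobiDiff_energy b (truncSeq b M v) M
  rw [truncSeq_of_le v le_rfl] at h
  have hnn : 0 ≤ ∑ j ∈ Finset.range M, jacobiKappa b (j + 1) *
      (truncSeq b M v (j + 1) - truncSeq b M v j) ^ 2 :=
    Finset.sum_nonneg fun j _ => mul_nonneg (jacobiKappa_nonneg hb _) (sq_nonneg _)
  have h2 : inner ℝ (truncOp b g M v) v
      = ∑ j ∈ Finset.range M, modeWeight b j * (freeEigenvalue b j + g) * truncSeq b M v j ^ 2
        - g * ∑ j ∈ Finset.range M, truncSeq b M v j * jacobiDiff b (truncSeq b M v) j := by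
    rw [inner_truncOp hb, Finset.mul_sum, ← Finset.sum_sub_distrib]
    exact Finset.sum_congr rfl fun j _ => by ring
  rw [h2, h]
  have := mul_nonneg hg.le hnn
  linarith

/-- The truncations have `N + 1` orthonormal eigenvectors with eigenvalues at most `d_N + γ`. -/
theorem exists_truncated_modes {b g : ℝ} (hb : 1 / 2 ≤ b) (hg : 0 < g) {N M : ℕ} (hM : N < M) :
    ∃ (μ : Fin (N + 1) → ℝ) (a : Fin (N + 1) → ℕ → ℝ),
      (∀ i, 0 ≤ μ i ∧ μ i ≤ freeEigenvalue b N + g) ∧ (∀ i j, M ≤ j → a i j = 0) ∧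
      (∀ i, ∀ j < M, modeWeight b j * (freeEigenvalue b j + g - μ i) * a i j
        = g * jacobiDiff b (a i) j) ∧
      (∀ i i', ∑ j ∈ Finset.range M, modeWeight b j * (a i j * a i' j) = if i = i' then 1 else 0) ∧
      ∀ i, ∑ j ∈ Finset.range M, modeWeight b j * freeEigenvalue b j * a i j ^ 2
        ≤ freeEigenvalue b N + g := by
  set Λ := freeEigenvalue b N + g with hΛ
  -- the span of the first `N + 1` basis vectors
  let e : Fin (N + 1) → EuclideanSpace ℝ (Fin M) :=
    fun i => EuclideanSpace.basisFun (Fin M) ℝ (Fin.castLE hM i)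
  have heo : Orthonormal ℝ e :=
    (EuclideanSpace.basisFun (Fin M) ℝ).orthonormal.comp _ (Fin.castLE_injective hM)
  let V := Submodule.span ℝ (Set.range e)
  have hV : N + 1 ≤ Module.finrank ℝ V := by
    rw [finrank_span_eq_card heo.linearIndependent, Fintype.card_fin]
  have hVz : ∀ v ∈ V, ∀ j, N < j → truncSeq b M v j = 0 := by
    intro v hv j hj
    induction hv using Submodule.span_induction with
    | mem x hx =>
      obtain ⟨i, rfl⟩ := hx
      by_cases h : j < M
      · have : (⟨j, h⟩ : Fin M) ≠ Fin.castLE hM i := by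
          intro h2
          have := congrArg Fin.val h2
          simp at this
          omega
        simp [truncSeq, e, this]
      · simp [truncSeq, h]
    | zero => simp
    | add x y _ _ hx hy => rw [map_add, Pi.add_apply, hx, hy, add_zero]
    | smul r x _ hx => rw [map_smul, Pi.smul_apply, hx, smul_zero]
  obtain ⟨f, μ, hf, hμ, hμΛ⟩ := (truncOp_isSymmetric hb g M).exists_orthonormal_eigenvectors V hV
    (Λ := Λ) (by
      intro v hv
      refine (inner_truncOp_le hb hg v).trans ?_
      rw [← real_inner_self_eq_norm_sq, inner_eq_truncSeq hb, Finset.mul_sum]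
      refine Finset.sum_le_sum fun j _ => ?_
      rcases lt_or_ge N j with hj | hj
      · rw [hVz v hv j hj]; simp
      · have h1 := (freeEigenvalue_strictMono hb).monotone hj
        have h2 : 0 ≤ modeWeight b j * truncSeq b M v j ^ 2 :=
          mul_nonneg (modeWeight_pos hb j).le (sq_nonneg _)
        have h3 : freeEigenvalue b j + g ≤ Λ := by rw [hΛ]; linarith
        have := mul_le_mul_of_nonneg_right h3 h2
        linarith)
  have hform : ∀ i, inner ℝ (truncOp b g M (f i)) (f i) = μ i := by
    intro i
    rw [hμ, real_inner_smul_left, real_inner_self_eq_norm_sq, hf.1 i]; simp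
  have hlow : ∀ i, ∑ j ∈ Finset.range M,
      modeWeight b j * freeEigenvalue b j * truncSeq b M (f i) j ^ 2 ≤ μ i := by
    intro i
    rw [← hform]
    exact le_inner_truncOp hb hg (f i)
  refine ⟨μ, fun i => truncSeq b M (f i), fun i => ⟨?_, hμΛ i⟩, fun i j hj => truncSeq_of_le _ hj,
    fun i j hj => ?_, fun i i' => ?_, fun i => (hlow i).trans (hμΛ i)⟩
  · refine le_trans (Finset.sum_nonneg fun j _ => ?_) (hlow i)
    have h1 := (sq_nonneg (j : ℝ)).trans (freeEigenvalue_ge hb j)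
    have h2 := modeWeight_pos hb j
    positivity
  · have h := truncSeq_truncOp (g := g) hb (f i) hj
    rw [hμ, map_smul, Pi.smul_apply, smul_eq_mul] at h
    linear_combination -h
  · rw [← inner_eq_truncSeq hb]
    exact orthonormal_iff_ite.mp hf i i'

theorem exists_tendsto_ultrafilter (U : Ultrafilter ℕ) {u : ℕ → ℝ} {C : ℝ}
    (h : ∀ᶠ n in (U : Filter ℕ), |u n| ≤ C) : ∃ x, Tendsto u U (𝓝 x) := by
  have hK : IsCompact (Set.Icc (-C) C) := isCompact_Icc
  obtain ⟨x, _, hx⟩ := hK.ultrafilter_le_nhds (U.map u)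
    (le_principal_iff.mpr (h.mono fun n hn => abs_le.mp hn))
  exact ⟨x, hx⟩

/-- At least `N + 1` eigenvalues do not exceed `d_N + γ`. The eigenvectors are limits along an
ultrafilter of those of the truncations; the bound on `⟨D a, a⟩` prevents loss of mass, so that the
limits are still orthonormal. -/
theorem exists_modes {b g : ℝ} (hb : 1 / 2 ≤ b) (hg : 0 < g) (N : ℕ) :
    ∃ s : Finset ℝ, s.card = N + 1 ∧ ∀ lam ∈ s, lam ≤ freeEigenvalue b N + g ∧
      ∃ a : ℕ → ℝ, a ≠ 0 ∧ RapidDecay a ∧ IsModeSeq b g lam a := by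
  set Λ := freeEigenvalue b N + g with hΛ
  have hΛ0 : 0 ≤ Λ := by
    have := (sq_nonneg (N : ℝ)).trans (freeEigenvalue_ge hb N)
    linarith
  choose μ a hμ hzero hrec horth hD using fun M => exists_truncated_modes hb hg
    (N := N) (M := M + N + 1) (by omega)
  let U : Ultrafilter ℕ := hyperfilter ℕ
  have hU : (U : Filter ℕ) ≤ atTop := by
    rw [← Nat.cofinite_eq_atTop]; exact hyperfilter_le_cofinite
  have hd0 : ∀ j, 0 ≤ freeEigenvalue b j := fun j =>
    (sq_nonneg (j : ℝ)).trans (freeEigenvalue_ge hb j)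
  -- combine the normalization with the bound on `⟨D a, a⟩`; the right side is summable in `j`
  have hbound : ∀ M i j, modeWeight b j * a M i j ^ 2 ≤ (1 + Λ) * (2 / ((j : ℝ) + 1) ^ 2) := by
    intro M i j
    have hpos : (0 : ℝ) < ((j : ℝ) + 1) ^ 2 := by positivity
    have hw := modeWeight_pos hb j
    rcases lt_or_ge j (M + N + 1) with hj | hj
    · have h1 : modeWeight b j * (a M i j * a M i j) ≤ 1 := by
        have := horth M i i
        rw [if_pos rfl] at this
        rw [← this]
        exact Finset.single_le_sum (f := fun j => modeWeight b j * (a M i j * a M i j))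
          (fun j _ => mul_nonneg (modeWeight_pos hb j).le (mul_self_nonneg _))
          (Finset.mem_range.mpr hj)
      have h2 : modeWeight b j * freeEigenvalue b j * a M i j ^ 2 ≤ Λ := by
        refine le_trans ?_ (hD M i)
        exact Finset.single_le_sum
          (f := fun j => modeWeight b j * freeEigenvalue b j * a M i j ^ 2)
          (fun j _ => mul_nonneg (mul_nonneg (modeWeight_pos hb j).le (hd0 j)) (sq_nonneg _))
          (Finset.mem_range.mpr hj)
      have h3 : ((j : ℝ) + 1) ^ 2 / 2 ≤ 1 + freeEigenvalue b j := by
        have := freeEigenvalue_ge hb j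
        nlinarith [sq_nonneg ((j : ℝ) - 1)]
      have h4 : 0 ≤ modeWeight b j * a M i j ^ 2 := mul_nonneg hw.le (sq_nonneg _)
      have h5 := mul_le_mul_of_nonneg_right h3 h4
      rw [← mul_div_assoc, le_div_iff₀ hpos]
      nlinarith
    · rw [hzero M i j hj]
      have : 0 ≤ 1 + Λ := by linarith
      simp only [ne_eq, OfNat.ofNat_ne_zero, not_false_eq_true, zero_pow, mul_zero]
      positivity
  have habs : ∀ M i j, |a M i j| ≤ 2 * (1 + Λ) + 1 := by
    intro M i j
    have h1 := hbound M i j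
    have h2 : 2 / ((j : ℝ) + 1) ^ 2 ≤ 2 := by
      refine div_le_self (by norm_num) ?_
      have := j.cast_nonneg (α := ℝ)
      nlinarith
    have h3 : 1 / 2 * a M i j ^ 2 ≤ modeWeight b j * a M i j ^ 2 := by
      refine mul_le_mul_of_nonneg_right ?_ (sq_nonneg _)
      unfold modeWeight
      have := j.cast_nonneg (α := ℝ)
      linarith
    have h4 : (1 + Λ) * (2 / ((j : ℝ) + 1) ^ 2) ≤ (1 + Λ) * 2 :=
      mul_le_mul_of_nonneg_left h2 (by linarith)
    refine abs_le_of_sq_le_sq ?_ (by linarith)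
    nlinarith
  choose A hA using fun i j => exists_tendsto_ultrafilter U (u := fun M => a M i j)
    (Eventually.of_forall fun M => habs M i j)
  choose ν hν using fun i => exists_tendsto_ultrafilter U (u := fun M => μ M i) (C := Λ)
    (Eventually.of_forall fun M => abs_le.mpr ⟨by linarith [(hμ M i).1], (hμ M i).2⟩)
  have hmode : ∀ i, IsModeSeq b g (ν i) (A i) := by
    intro i j
    have h1 : Tendsto (fun M => modeWeight b j * (freeEigenvalue b j + g - μ M i) * a M i j) U
        (𝓝 (modeWeight b j * (freeEigenvalue b j + g - ν i) * A i j)) :=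
      (((hν i).const_sub _).const_mul _).mul (hA i j)
    have h2 : Tendsto (fun M => g * jacobiDiff b (a M i) j) U (𝓝 (g * jacobiDiff b (A i) j)) :=
      ((((hA i j).sub (hA i (j - 1))).const_mul _).sub
        (((hA i (j + 1)).sub (hA i j)).const_mul _)).const_mul g
    refine tendsto_nhds_unique (h1.congr' ?_) h2
    filter_upwards [hU (eventually_ge_atTop j)] with M hM
    exact hrec M i j (by omega)
  have hrap : ∀ i, RapidDecay (A i) := fun i =>
    (hmode i).rapidDecay hb hg ⟨2 * (1 + Λ) + 1, 1, le_rfl, fun j => by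
      rw [one_pow, mul_one]
      exact le_of_tendsto (hA i j).abs (Eventually.of_forall fun M => habs M i j)⟩
  have hinner : ∀ i i', seqInner b (A i) (A i') = if i = i' then 1 else 0 := by
    intro i i'
    have h1 : Tendsto (fun M => ∑' j, modeWeight b j * (a M i j * a M i' j)) U
        (𝓝 (seqInner b (A i) (A i'))) := by
      refine tendsto_tsum_of_dominated_convergence
        (bound := fun j => (1 + Λ) * (2 / ((j : ℝ) + 1) ^ 2)) ?_ ?_ ?_
      · refine Summable.mul_left _ ?_
        have := (summable_nat_add_iff 1).mpr (Real.summable_one_div_nat_pow.mpr one_lt_two)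
        refine (this.mul_left 2).congr fun j => ?_
        push_cast; ring
      · exact fun j => ((hA i j).mul (hA i' j)).const_mul _
      · refine Eventually.of_forall fun M j => ?_
        have h1 := hbound M i j
        have h2 := hbound M i' j
        have hw := modeWeight_pos hb j
        rw [Real.norm_eq_abs, abs_mul, abs_of_pos hw, abs_mul]
        have h3 := two_mul_le_add_sq |a M i j| |a M i' j|
        rw [sq_abs, sq_abs] at h3
        have := mul_le_mul_of_nonneg_left h3 hw.le
        linarith
    refine tendsto_nhds_unique h1 (tendsto_const_nhds.congr fun M => ?_)
    rw [← horth M i i', tsum_eq_sum]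
    intro j hj
    rw [Finset.mem_range, not_lt] at hj
    rw [hzero M i j hj, zero_mul, mul_zero]
  have hne : ∀ i, A i ≠ 0 := by
    intro i h0
    have := hinner i i
    rw [h0, if_pos rfl] at this
    simp [seqInner] at this
  have hinj : Function.Injective ν := by
    intro i i' hii
    by_contra hne'
    -- eigenvalues are simple, so orthogonal eigenvectors have different eigenvalues
    have hz : ∀ j, A i' 0 * A i j + -(A i 0) * A i' j = 0 := by
      have h1 := (hmode i).linear_comb (hii ▸ hmode i') (A i' 0) (-(A i 0))
      exact h1.eq_zero hb hg (by ring)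
    have h2 : A i' 0 * seqInner b (A i) (A i) + -(A i 0) * seqInner b (A i') (A i) = 0 := by
      have h3 := ((seqInner_hasSum hb (hrap i) (hrap i)).mul_left (A i' 0)).add
        ((seqInner_hasSum hb (hrap i') (hrap i)).mul_left (-(A i 0)))
      refine h3.unique ?_
      convert hasSum_zero using 1
      ext j
      linear_combination modeWeight b j * A i j * hz j
    rw [hinner, hinner, if_pos rfl, if_neg (fun h => hne' h.symm), mul_zero, add_zero,
      mul_one] at h2
    exact hne i' (funext fun j => (hmode i').eq_zero hb hg h2 j)
  refine ⟨Finset.univ.image ν, by rw [Finset.card_image_of_injective _ hinj]; simp, ?_⟩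
  intro lam hlam
  obtain ⟨i, -, rfl⟩ := Finset.mem_image.mp hlam
  exact ⟨le_of_tendsto (hν i) (Eventually.of_forall fun M => (hμ M i).2), A i, hne i, hrap i,
    hmode i⟩

/-! ### The radial equation and Jacobi coefficients -/

/-- The operator `D + γ (1 - s)` acting on polynomials in `s`. -/
def jacobiOp (b g : ℝ) (q : ℝ[X]) : ℝ[X] :=
  C (4 * b) * (X * derivative q) - C 4 * ((1 - X) * derivative (X * derivative q))
    + C g * ((1 - X) * q)

theorem hasDerivAt_comp_sq {f : ℝ → ℝ} {f' r : ℝ} (h : HasDerivAt f f' (r ^ 2)) :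
    HasDerivAt (fun r => f (r ^ 2)) (f' * (2 * r)) r :=
  HasDerivAt.comp (h₂ := f) (h := fun r => r ^ 2) r h (by simpa using hasDerivAt_pow 2 r)

theorem hasDerivAt_eval_one_sub_sq (q : ℝ[X]) (r : ℝ) :
    HasDerivAt (fun r => q.eval (1 - r ^ 2)) ((derivative q).eval (1 - r ^ 2) * -(2 * r)) r := by
  have h : HasDerivAt (fun r : ℝ => 1 - r ^ 2) (-(2 * r)) r := by
    simpa using (hasDerivAt_pow 2 r).const_sub 1
  exact HasDerivAt.comp (h₂ := fun s => q.eval s) (h := fun r => 1 - r ^ 2) r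
    (q.hasDerivAt (1 - r ^ 2)) h

/-- A solution of the radial equation, in two guises: `P` solves the equation in `t = |x|²` on
`(0, 1)`, and `φ(r) = r ^ k P(r²)`, with derivative `φ'`, is regular on `[0, 1]`. -/
structure IsRadialSolution (k m : ℕ) (g lam : ℝ) (φ φ' P : ℝ → ℝ) : Prop where
  cont : ContinuousOn φ (Set.Icc 0 1)
  cont' : ContinuousOn φ' (Set.Icc 0 1)
  eq : ∀ r ∈ Set.Ioo (0 : ℝ) 1, φ r = r ^ k * P (r ^ 2)
  deriv_eq : ∀ r ∈ Set.Ioo (0 : ℝ) 1, HasDerivAt φ (φ' r) r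
  zero : k ≠ 0 → φ 0 = 0
  zero' : k = 0 → φ' 0 = 0
  ode : ∃ P₁ P₂ : ℝ → ℝ, ∀ t ∈ Set.Ioo (0 : ℝ) 1, HasDerivAt P (P₁ t) t ∧
    HasDerivAt P₁ (P₂ t) t ∧
    -4 * t * ((1 - t) * P₂ t - P₁ t) - 2 * (2 * k + m) * (1 - t) * P₁ t + g * t * P t = lam * P t

/-- Symmetry of the radial operator: the boundary terms vanish because of the factor `1 - r²` at
`r = 1` and because of regularity at `r = 0`. -/
theorem IsRadialSolution.integral_eq_zero {k m : ℕ} (hm : 1 ≤ m) {g lam : ℝ} {φ φ' P : ℝ → ℝ}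
    (h : IsRadialSolution k m g lam φ φ' P) (q : ℝ[X]) :
    ∫ r in (0 : ℝ)..1, r ^ (k + m - 1) * φ r *
      (jacobiOp (k + m / 2) g q - C lam * q).eval (1 - r ^ 2) = 0 := by
  obtain ⟨P₁, P₂, hode⟩ := h.ode
  have hc := h.cont
  have hc' := h.cont'
  -- the Wronskian of `P(r²)` and `q(1 - r²)`, times `r ^ (2k + m - 1) (1 - r²)`; in terms of `φ` it
  -- extends to `[0, 1]` (for `k = 0` the truncated exponent `k + m - 2` has the factor `k = 0`)
  set W : ℝ → ℝ := fun r => (1 - r ^ 2) *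
    ((r ^ (k + m - 1) * φ' r - k * r ^ (k + m - 2) * φ r) * q.eval (1 - r ^ 2)
      + 2 * r ^ (k + m) * φ r * (derivative q).eval (1 - r ^ 2)) with hW
  have hWc : ContinuousOn W (Set.Icc 0 1) := by
    simp only [hW]
    fun_prop
  have hW1 : W 1 = 0 := by simp [hW]
  have hW0 : W 0 = 0 := by
    have h1 : (0 : ℝ) ^ (k + m - 1) * φ' 0 = 0 := by
      by_cases hk : k = 0
      · rw [h.zero' hk, mul_zero]
      · rw [zero_pow (by omega), zero_mul]
    have h2 : (k : ℝ) * 0 ^ (k + m - 2) * φ 0 = 0 := by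
      by_cases hk : k = 0
      · simp [hk]
      · rw [h.zero hk, mul_zero]
    have h3 : (0 : ℝ) ^ (k + m) = 0 := zero_pow (by omega)
    simp only [hW, h1, h2, h3]; ring
  have hWP : ∀ r ∈ Set.Ioo (0 : ℝ) 1, W r = (1 - r ^ 2) * r ^ (2 * k + m) *
      (2 * (P₁ (r ^ 2) * q.eval (1 - r ^ 2) + P (r ^ 2) * (derivative q).eval (1 - r ^ 2))) := by
    intro r hr
    have hr2 : r ^ 2 ∈ Set.Ioo (0 : ℝ) 1 := ⟨by have := hr.1; positivity, by
      have := hr.1; have := hr.2; nlinarith⟩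
    have hφ' : φ' r = k * r ^ (k - 1) * P (r ^ 2) + r ^ k * (P₁ (r ^ 2) * (2 * r)) := by
      have h1 : HasDerivAt (fun r => r ^ k * P (r ^ 2))
          (k * r ^ (k - 1) * P (r ^ 2) + r ^ k * (P₁ (r ^ 2) * (2 * r))) r := by
        exact (hasDerivAt_pow k r).mul (hasDerivAt_comp_sq (hode _ hr2).1)
      refine (h.deriv_eq r hr).unique (h1.congr_of_eventuallyEq ?_)
      filter_upwards [Ioo_mem_nhds hr.1 hr.2] with y hy using h.eq y hy
    simp only [hW]
    rw [hφ', h.eq r hr]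
    have e1 : r ^ (k + m - 1) * (k * r ^ (k - 1)) = k * r ^ (k + m - 2) * r ^ k := by
      by_cases hk : k = 0
      · simp [hk]
      · have : r ^ (k + m - 1) * r ^ (k - 1) = r ^ (k + m - 2) * r ^ k := by
          rw [← pow_add, ← pow_add]; congr 1; omega
        linear_combination (k : ℝ) * this
    have e2 : r ^ (k + m - 1) * r ^ k * r = r ^ (2 * k + m) := by
      rw [← pow_add, ← pow_succ]; congr 1; omega
    have e3 : r ^ (k + m) * r ^ k = r ^ (2 * k + m) := by
      rw [← pow_add]; congr 1; omega
    linear_combination ((1 - r ^ 2) * P (r ^ 2) * q.eval (1 - r ^ 2)) * e1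
      + ((1 - r ^ 2) * 2 * P₁ (r ^ 2) * q.eval (1 - r ^ 2)) * e2
      + ((1 - r ^ 2) * 2 * P (r ^ 2) * (derivative q).eval (1 - r ^ 2)) * e3
  have hWd : ∀ r ∈ Set.Ioo (0 : ℝ) 1, HasDerivAt W (r ^ (k + m - 1) * φ r *
      (jacobiOp (k + m / 2) g q - C lam * q).eval (1 - r ^ 2)) r := by
    intro r hr
    have hr2 : r ^ 2 ∈ Set.Ioo (0 : ℝ) 1 := ⟨by have := hr.1; positivity, by
      have := hr.1; have := hr.2; nlinarith⟩
    have h3 : HasDerivAt (fun r : ℝ => 1 - r ^ 2) (-(2 * r)) r := by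
      simpa using (hasDerivAt_pow 2 r).const_sub 1
    obtain ⟨hP, hP₁, ho⟩ := hode _ hr2
    have hP' := hasDerivAt_comp_sq hP
    have hP₁' := hasDerivAt_comp_sq hP₁
    have hq := hasDerivAt_eval_one_sub_sq q r
    have hq' := hasDerivAt_eval_one_sub_sq (derivative q) r
    have key := (h3.mul (hasDerivAt_pow (2 * k + m) r)).mul
      (((hP₁'.mul hq).add (hP'.mul hq')).const_mul 2)
    have key2 := key.congr_of_eventuallyEq (f₁ := W) (by
      filter_upwards [Ioo_mem_nhds hr.1 hr.2] with y hy using hWP y hy)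
    refine key2.congr_deriv ?_
    symm
    rw [h.eq r hr]
    have e1 : r ^ (k + m - 1) * r ^ k = r ^ (2 * k + m - 1) := by
      rw [← pow_add]; congr 1; omega
    have e2 : r ^ (2 * k + m) = r ^ (2 * k + m - 1) * r := by
      rw [← pow_succ]; congr 1; omega
    simp only [jacobiOp, eval_sub, eval_add, eval_mul, eval_C, eval_X, eval_one, derivative_mul,
      derivative_X, one_mul, Pi.mul_apply, Pi.add_apply]
    rw [e2]
    push_cast
    linear_combination (P (r ^ 2) *
        (4 * (k + m / 2) * ((1 - r ^ 2) * eval (1 - r ^ 2) (derivative q))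
          - 4 * ((1 - (1 - r ^ 2)) * (eval (1 - r ^ 2) (derivative q)
            + (1 - r ^ 2) * eval (1 - r ^ 2) (derivative (derivative q))))
          + g * ((1 - (1 - r ^ 2)) * eval (1 - r ^ 2) q) - lam * eval (1 - r ^ 2) q)) * e1
      + r ^ (2 * k + m - 1) * eval (1 - r ^ 2) q * ho
  rw [intervalIntegral.integral_eq_sub_of_hasDerivAt_of_le zero_le_one hWc hWd, hW1, hW0, sub_zero]
  refine ContinuousOn.intervalIntegrable ?_
  rw [Set.uIcc_of_le zero_le_one]
  fun_prop

/-- The Jacobi coefficients of a function on `[0, 1]`. -/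
def jacobiIntegral (b : ℝ) (f : ℝ → ℝ) (j : ℕ) : ℝ :=
  ∫ r in (0 : ℝ)..1, f r * (jacobiPoly b j).eval (1 - r ^ 2)

theorem intervalIntegrable_mul_poly {f : ℝ → ℝ} (hf : ContinuousOn f (Set.Icc 0 1)) (q : ℝ[X]) :
    IntervalIntegrable (fun r => f r * q.eval (1 - r ^ 2)) MeasureTheory.volume 0 1 := by
  refine ContinuousOn.intervalIntegrable ?_
  rw [Set.uIcc_of_le zero_le_one]
  fun_prop

/-- The linear functional `q ↦ ∫ f q(1 - r²)` on polynomials. -/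
def polyIntegral (f : ℝ → ℝ) (hf : ContinuousOn f (Set.Icc 0 1)) : ℝ[X] →ₗ[ℝ] ℝ where
  toFun q := ∫ r in (0 : ℝ)..1, f r * q.eval (1 - r ^ 2)
  map_add' p q := by
    rw [← intervalIntegral.integral_add (intervalIntegrable_mul_poly hf p)
      (intervalIntegrable_mul_poly hf q)]
    simp only [eval_add, mul_add]
  map_smul' c q := by
    rw [RingHom.id_apply, smul_eq_mul, ← intervalIntegral.integral_const_mul]
    congr 1; ext r
    rw [eval_smul, smul_eq_mul]; ring

theorem polyIntegral_C_mul {f : ℝ → ℝ} (hf : ContinuousOn f (Set.Icc 0 1)) (c : ℝ) (q : ℝ[X]) :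
    polyIntegral f hf (C c * q) = c * polyIntegral f hf q := by
  rw [← smul_eq_C_mul, map_smul, smul_eq_mul]

theorem polyIntegral_X_mul {f : ℝ → ℝ} (hf : ContinuousOn f (Set.Icc 0 1)) {b : ℝ}
    (hb : 1 / 2 ≤ b) (j : ℕ) :
    modeWeight b j * polyIntegral f hf (X * jacobiPoly b j)
      = jacobiDiff b (jacobiIntegral b f) j := by
  rw [← polyIntegral_C_mul, jacobiDiff_eval hb, map_sub, polyIntegral_C_mul, polyIntegral_C_mul,
    map_sub, map_sub]
  rfl

theorem jacobiOp_jacobiPoly (b g : ℝ) (j : ℕ) :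
    jacobiOp b g (jacobiPoly b j)
      = C (freeEigenvalue b j + g) * jacobiPoly b j - C g * (X * jacobiPoly b j) := by
  rw [jacobiOp, jacobiPoly_ode, C_add]; ring

theorem IsRadialSolution.isModeSeq {k m : ℕ} (hm : 1 ≤ m) {g lam : ℝ} {φ φ' P : ℝ → ℝ}
    (h : IsRadialSolution k m g lam φ φ' P) (hb : (1 : ℝ) / 2 ≤ k + m / 2) :
    IsModeSeq (k + m / 2) g lam
      (jacobiIntegral (k + m / 2) fun r => r ^ (k + m - 1) * φ r) := by
  intro j
  have hc := h.cont
  have hf : ContinuousOn (fun r => r ^ (k + m - 1) * φ r) (Set.Icc 0 1) := by fun_prop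
  have h1 : polyIntegral _ hf (jacobiOp (k + m / 2) g (jacobiPoly (k + m / 2) j)
      - C lam * jacobiPoly (k + m / 2) j) = 0 := h.integral_eq_zero hm _
  rw [jacobiOp_jacobiPoly, map_sub, map_sub, polyIntegral_C_mul, polyIntegral_C_mul,
    polyIntegral_C_mul] at h1
  have h2 := polyIntegral_X_mul hf hb j
  have h3 : polyIntegral _ hf (jacobiPoly (k + m / 2) j)
      = jacobiIntegral (k + m / 2) (fun r => r ^ (k + m - 1) * φ r) j := rfl
  rw [h3] at h1
  rw [← h2]
  linear_combination modeWeight (k + m / 2) j * h1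

theorem jacobiIntegral_geomBounded {b : ℝ} (hb : 1 / 2 ≤ b) {f : ℝ → ℝ}
    (hf : ContinuousOn f (Set.Icc 0 1)) : GeomBounded (jacobiIntegral b f) := by
  obtain ⟨R, hR, hbd⟩ := jacobiPoly_bound hb
  obtain ⟨C, hC⟩ := isCompact_Icc.exists_bound_of_continuousOn hf
  refine ⟨C, R, hR, fun j => ?_⟩
  have := intervalIntegral.norm_integral_le_of_norm_le_const (a := (0 : ℝ)) (b := 1)
    (f := fun r => f r * (jacobiPoly b j).eval (1 - r ^ 2)) (C := C * R ^ j) (by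
      intro r hr
      rw [Set.uIoc_of_le zero_le_one] at hr
      have h1 := hC r ⟨hr.1.le, hr.2⟩
      have h2 : |1 - r ^ 2| ≤ 2 := by
        rw [abs_le]; constructor <;> nlinarith [hr.1, hr.2]
      rw [norm_mul]
      exact mul_le_mul h1 (hbd j _ h2).1 (norm_nonneg _) ((norm_nonneg _).trans h1))
  simpa [jacobiIntegral] using this

/-- Completeness of the Jacobi polynomials: a continuous function with vanishing Jacobi
coefficients is zero. -/
theorem eq_zero_of_jacobiIntegral {b : ℝ} (hb : 1 / 2 ≤ b) {f : ℝ → ℝ}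
    (hf : ContinuousOn f (Set.Icc 0 1)) (h : ∀ j, jacobiIntegral b f j = 0) :
    ∀ r ∈ Set.Icc (0 : ℝ) 1, f r = 0 := by
  -- the recurrence shows that `∫ f s ^ i p_j` vanishes for all `i` and `j`
  have h1 : ∀ i j, polyIntegral f hf (X ^ i * jacobiPoly b j) = 0 := by
    intro i
    induction i with
    | zero => intro j; rw [pow_zero, one_mul]; exact h j
    | succ i ih =>
      intro j
      have h2 : C (modeWeight b j) * (X ^ (i + 1) * jacobiPoly b j)
          = C (jacobiKappa b j) * (X ^ i * jacobiPoly b j - X ^ i * jacobiPoly b (j - 1))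
            - C (jacobiKappa b (j + 1)) *
              (X ^ i * jacobiPoly b (j + 1) - X ^ i * jacobiPoly b j) := by
        linear_combination X ^ i * jacobiDiff_eval hb j
      have h3 := congrArg (polyIntegral f hf) h2
      rw [polyIntegral_C_mul, map_sub, polyIntegral_C_mul, polyIntegral_C_mul, map_sub, map_sub,
        ih, ih, ih] at h3
      simpa [(modeWeight_pos hb j).ne'] using h3
  have h2 : ∀ q : ℝ[X], polyIntegral f hf q = 0 := by
    intro q
    induction q using Polynomial.induction_on' with
    | add p q hp hq => rw [map_add, hp, hq, add_zero]
    | monomial n a =>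
      rw [← C_mul_X_pow_eq_monomial, polyIntegral_C_mul]
      have := h1 n 0
      rw [show jacobiPoly b 0 = 1 by simp [jacobiPoly, jacobiCoeff], mul_one] at this
      rw [this, mul_zero]
  obtain ⟨K, hK⟩ := isCompact_Icc.exists_bound_of_continuousOn hf
  have hK0 : 0 ≤ K := (norm_nonneg _).trans (hK 0 ⟨le_rfl, zero_le_one⟩)
  have hint : ∫ r in (0 : ℝ)..1, f r * f r ≤ 0 := by
    refine le_of_forall_pos_le_add fun ε hε => ?_
    have hg : ContinuousOn (fun s => f (√(1 - s))) (Set.Icc 0 1) := by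
      refine hf.comp (by fun_prop) fun s hs => ⟨Real.sqrt_nonneg _, ?_⟩
      rw [Real.sqrt_le_one]; linarith [hs.1]
    obtain ⟨q, hq⟩ := exists_polynomial_near_of_continuousOn 0 1 _ hg (ε / (K + 1)) (by positivity)
    have h3 : ∫ r in (0 : ℝ)..1, f r * f r
        = ∫ r in (0 : ℝ)..1, f r * (f r - q.eval (1 - r ^ 2)) := by
      have h4 : ∫ r in (0 : ℝ)..1, f r * q.eval (1 - r ^ 2) = 0 := h2 q
      have h5 : IntervalIntegrable (fun r => f r * f r) MeasureTheory.volume 0 1 := by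
        refine ContinuousOn.intervalIntegrable ?_
        rw [Set.uIcc_of_le zero_le_one]
        exact hf.mul hf
      simp only [mul_sub]
      rw [intervalIntegral.integral_sub h5 (intervalIntegrable_mul_poly hf q), h4, sub_zero]
    have h6 := intervalIntegral.norm_integral_le_of_norm_le_const (a := (0 : ℝ)) (b := 1)
      (f := fun r => f r * (f r - q.eval (1 - r ^ 2))) (C := K * (ε / (K + 1))) (by
        intro r hr
        rw [Set.uIoc_of_le zero_le_one] at hr
        have h1 := hK r ⟨hr.1.le, hr.2⟩
        have h2 := hq (1 - r ^ 2) ⟨by nlinarith [hr.1, hr.2], by nlinarith [hr.1]⟩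
        rw [sub_sub_cancel, Real.sqrt_sq hr.1.le, abs_sub_comm] at h2
        rw [norm_mul]
        exact mul_le_mul h1 h2.le (norm_nonneg _) hK0)
    have h7 : K * (ε / (K + 1)) ≤ ε := by
      rw [← mul_div_assoc, div_le_iff₀ (by positivity)]; nlinarith
    rw [h3, zero_add]
    refine (le_abs_self _).trans ((h6.trans_eq ?_).trans h7)
    simp
  intro r hr
  by_contra hne
  exact hint.not_gt (intervalIntegral.integral_pos zero_lt_one (hf.mul hf)
    (fun x _ => mul_self_nonneg _) ⟨r, hr, mul_self_pos.mpr hne⟩)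

/-! ### From wave functions to solutions of the recurrence -/

/-- The restriction of an even wave function to a ray, read off by a linear functional, is a
solution of the radial equation. -/
theorem IsEvenCPSWF.exists_isRadialSolution {m k : ℕ} (hm : 1 ≤ m) {Y : RSpace m → Cl m}
    (hY : IsSphericalMonogenic k Y) {c χ : ℝ} {ψ : RSpace m → Cl m} (h : IsEvenCPSWF Y c χ ψ) :
    ∃ φ φ' P : ℝ → ℝ, IsRadialSolution k m (4 * Real.pi ^ 2 * c ^ 2) χ φ φ' P ∧
      ∃ r ∈ Set.Icc (0 : ℝ) 1, φ r ≠ 0 := by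
  obtain ⟨P, hP⟩ := h.form
  obtain ⟨x₁, hx₁, hψ₁⟩ := h.nonzero
  have hx₁' : ‖x₁‖ ≤ 1 := by simpa using hx₁
  have hYx₁ : Y x₁ ≠ 0 := fun h0 => hψ₁ (by rw [hP x₁ hx₁, h0, smul_zero])
  obtain ⟨x₀, hx₀, hYx₀⟩ := hY.1.exists_unit hm (fun h0 => hYx₁ (by rw [h0]; rfl))
  obtain ⟨ℓ, hℓ⟩ := SeparatingDual.exists_eq_one (R := ℝ) hYx₀
  set φ : ℝ → ℝ := fun r => ℓ (ψ (r • x₀)) with hφ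
  have hmem : ∀ r ∈ Set.Icc (-1 : ℝ) 1, r • x₀ ∈ Metric.closedBall (0 : RSpace m) 1 := by
    intro r hr
    rw [mem_closedBall_zero_iff, norm_smul, hx₀, mul_one]
    exact abs_le.mpr hr
  have hφc : ContDiffOn ℝ 2 φ (Set.Icc (-1) 1) := by
    refine ℓ.contDiff.comp_contDiffOn (h.smooth.comp ?_ hmem)
    exact (contDiff_id.smul contDiff_const).contDiffOn
  have hφeq : ∀ r ∈ Set.Icc (-1 : ℝ) 1, φ r = r ^ k * P (r ^ 2) := by
    intro r hr
    simp only [hφ]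
    rw [hP _ (hmem r hr), norm_smul, hx₀, mul_one, Real.norm_eq_abs, sq_abs, hY.1.smul_apply,
      map_smul, map_smul, hℓ]
    simp only [smul_eq_mul]; ring
  have hud : UniqueDiffOn ℝ (Set.Icc (-1 : ℝ) 1) := uniqueDiffOn_Icc (by norm_num)
  set φ' : ℝ → ℝ := derivWithin φ (Set.Icc (-1) 1) with hφ'
  have hsub : Set.Icc (0 : ℝ) 1 ⊆ Set.Icc (-1) 1 := Set.Icc_subset_Icc_left (by norm_num)
  have hderiv : ∀ r ∈ Set.Ioo (-1 : ℝ) 1, HasDerivAt φ (φ' r) r := by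
    intro r hr
    have h1 : DifferentiableWithinAt ℝ φ (Set.Icc (-1) 1) r :=
      (hφc.differentiableOn (by norm_num)) r ⟨hr.1.le, hr.2.le⟩
    exact h1.hasDerivWithinAt.hasDerivAt (Icc_mem_nhds hr.1 hr.2)
  refine ⟨φ, φ', P, ⟨hφc.continuousOn.mono hsub,
    (hφc.continuousOn_derivWithin hud (by norm_num)).mono hsub,
    fun r hr => hφeq r ⟨by linarith [hr.1], hr.2.le⟩,
    fun r hr => hderiv r ⟨by linarith [hr.1], hr.2⟩, fun hk => ?_, fun hk => ?_, ?_⟩,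
    ‖x₁‖, ⟨norm_nonneg _, hx₁'⟩, ?_⟩
  · rw [hφeq 0 (by norm_num), zero_pow hk, zero_mul]
  · -- for `k = 0` the function `φ` is even
    have h1 := hderiv 0 (by norm_num)
    have h2 : HasDerivAt φ (φ' 0 * -1) 0 := by
      have h3 : HasDerivAt φ (φ' 0) (-0) := by rwa [neg_zero]
      have h4 := HasDerivAt.comp (h₂ := φ) (h := fun r : ℝ => -r) 0 h3 (hasDerivAt_neg 0)
      refine h4.congr_of_eventuallyEq ?_
      filter_upwards [Icc_mem_nhds (show (-1 : ℝ) < 0 by norm_num) (show (0 : ℝ) < 1 by norm_num)]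
        with r hr
      rw [Function.comp_apply, hφeq r hr, hφeq (-r) ⟨by linarith [hr.2], by linarith [hr.1]⟩, hk,
        pow_zero, pow_zero, neg_sq]
    linarith [h1.unique h2]
  · have hPsmooth : ContDiffOn ℝ 2 P (Set.Ioo 0 1) := by
      have h1 : ContDiffOn ℝ 2 (fun t => φ (√t) / (√t) ^ k) (Set.Ioo 0 1) := by
        have hs : ContDiffOn ℝ 2 (fun t => √t) (Set.Ioo 0 1) := fun t ht =>
          (Real.contDiffAt_sqrt ht.1.ne').contDiffWithinAt
        refine ContDiffOn.div (hφc.comp hs fun t ht => ⟨?_, ?_⟩) (hs.pow k) fun t ht => ?_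
        · linarith [Real.sqrt_nonneg t]
        · exact Real.sqrt_le_one.mpr ht.2.le
        · exact pow_ne_zero _ (Real.sqrt_pos.mpr ht.1).ne'
      refine h1.congr fun t ht => ?_
      have h2 : (√t) ^ k ≠ 0 := pow_ne_zero _ (Real.sqrt_pos.mpr ht.1).ne'
      rw [hφeq (√t) ⟨by linarith [Real.sqrt_nonneg t], Real.sqrt_le_one.mpr ht.2.le⟩,
        Real.sq_sqrt ht.1.le]
      field_simp
    have hP1 : ∀ t ∈ Set.Ioo (0 : ℝ) 1, HasDerivAt P (deriv P t) t := fun t ht =>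
      ((hPsmooth.differentiableOn (by norm_num)).differentiableAt
        (Ioo_mem_nhds ht.1 ht.2)).hasDerivAt
    have hP2 : ∀ t ∈ Set.Ioo (0 : ℝ) 1, HasDerivAt (deriv P) (deriv (deriv P) t) t := by
      intro t ht
      have h2 : ContDiffOn ℝ 1 (deriv P) (Set.Ioo 0 1) :=
        hPsmooth.deriv_of_isOpen isOpen_Ioo (by norm_num)
      exact ((h2.differentiableOn (by norm_num)).differentiableAt
        (Ioo_mem_nhds ht.1 ht.2)).hasDerivAt
    refine ⟨deriv P, deriv (deriv P), fun t ht => ⟨hP1 t ht, hP2 t ht, ?_⟩⟩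
    -- the eigenvalue equation at the point `√t x₀`
    set x : RSpace m := √t • x₀ with hx
    have hxn : ‖x‖ = √t := by
      rw [hx, norm_smul, hx₀, mul_one, Real.norm_eq_abs, abs_of_nonneg (Real.sqrt_nonneg t)]
    have hxt : ‖x‖ ^ 2 = t := by rw [hxn, Real.sq_sqrt ht.1.le]
    have hxb : x ∈ Metric.ball (0 : RSpace m) 1 := by
      rw [mem_ball_zero_iff, hxn, Real.sqrt_lt' one_pos]
      simpa using ht.2
    have hev : ∀ᶠ y in 𝓝 x, ‖y‖ ^ 2 ∈ Set.Ioo (0 : ℝ) 1 := by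
      have hcont : ContinuousAt (fun y : RSpace m => ‖y‖ ^ 2) x := by fun_prop
      refine hcont.eventually_mem (Ioo_mem_nhds ?_ ?_)
      · rw [hxt]; exact ht.1
      · rw [hxt]; exact ht.2
    have hL := cliffordL_radial hY c (P := P) (P₁ := deriv P) (P₂ := deriv (deriv P) t) (ψ := ψ)
      (x := x) ?_ (hev.mono fun y hy => hP1 _ hy) (by rw [hxt]; exact hP2 t ht)
    · rw [h.eigen x hxb, hP x (Metric.ball_subset_closedBall hxb), smul_smul, hxt] at hL
      have hYx : Y x ≠ 0 := by
        rw [hx, hY.1.smul_apply]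
        exact smul_ne_zero (pow_ne_zero _ (Real.sqrt_pos.mpr ht.1).ne') hYx₀
      exact (smul_left_injective ℝ hYx hL).symm
    · filter_upwards [Metric.isOpen_ball.mem_nhds hxb] with y hy
        using hP y (Metric.ball_subset_closedBall hy)
  · rw [hφeq _ ⟨by linarith [norm_nonneg x₁], hx₁'⟩]
    refine mul_ne_zero (fun h0 => hYx₁ ?_) (fun h0 => hψ₁ (by rw [hP x₁ hx₁, h0, zero_smul]))
    have hk : k ≠ 0 := fun hk => by simp [hk] at h0
    have hx0 : x₁ = 0 := norm_eq_zero.mp (pow_eq_zero_iff hk |>.mp h0)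
    have := hY.1.smul_apply 0 x₁
    rwa [zero_smul, zero_pow hk, zero_smul, ← hx0] at this

theorem half_le_index {m : ℕ} (hm : 1 ≤ m) (k : ℕ) : (1 : ℝ) / 2 ≤ k + m / 2 := by
  have h1 : (1 : ℝ) ≤ m := by exact_mod_cast hm
  have h2 := k.cast_nonneg (α := ℝ)
  linarith

/-- The Jacobi coefficients of an even wave function are a nonzero, rapidly decaying solution of
the recurrence. -/
theorem IsEvenCPSWF.exists_isModeSeq {m k : ℕ} (hm : 1 ≤ m) {Y : RSpace m → Cl m}
    (hY : IsSphericalMonogenic k Y) {c χ : ℝ} (hc : 0 < c) {ψ : RSpace m → Cl m}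
    (h : IsEvenCPSWF Y c χ ψ) :
    ∃ a : ℕ → ℝ, a ≠ 0 ∧ RapidDecay a ∧ IsModeSeq (k + m / 2) (4 * Real.pi ^ 2 * c ^ 2) χ a := by
  obtain ⟨φ, φ', P, hr, r, hr1, hφr⟩ := h.exists_isRadialSolution hm hY
  have hb := half_le_index hm k
  have hφc := hr.cont
  have hf : ContinuousOn (fun r => r ^ (k + m - 1) * φ r) (Set.Icc 0 1) := by fun_prop
  have hmode := hr.isModeSeq hm hb
  refine ⟨_, fun h0 => hφr ?_, hmode.rapidDecay hb (by positivity)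
    (jacobiIntegral_geomBounded hb hf), hmode⟩
  have hz := eq_zero_of_jacobiIntegral hb hf (fun j => congrFun h0 j)
  have h1 : Set.EqOn φ 0 (Set.Ioc 0 1) := by
    intro y hy
    have := hz y ⟨hy.1.le, hy.2⟩
    exact (mul_eq_zero.mp this).resolve_left (pow_ne_zero _ hy.1.ne')
  exact h1.of_subset_closure hφc continuousOn_const Set.Ioc_subset_Icc_self
    (by rw [closure_Ioc zero_ne_one]) hr1

/-! ### From solutions of the recurrence to wave functions -/

/-- The Jacobi series with coefficients `a`, differentiated `l` times term by term. It converges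
near `[0, 1]` for rapidly decaying `a` and `l ≤ 2` (`jacobiSeries_hasSum`). -/
def jacobiSeries (b : ℝ) (a : ℕ → ℝ) (l : ℕ) (s : ℝ) : ℝ :=
  ∑' j, modeWeight b j * a j * (derivative^[l] (jacobiPoly b j)).eval s

/-- A summable bound for the terms, uniform in `|s| < 2`; the margin around `[0, 1]` provides
regularity up to the boundary of the ball. -/
theorem jacobiSeries_bound {b : ℝ} (hb : 1 / 2 ≤ b) {a : ℕ → ℝ} (ha : RapidDecay a) :
    ∃ u : ℕ → ℝ, Summable u ∧ ∀ l ≤ 2, ∀ j, ∀ s ∈ Set.Ioo (-2 : ℝ) 2,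
      ‖modeWeight b j * a j * (derivative^[l] (jacobiPoly b j)).eval s‖ ≤ u j := by
  obtain ⟨R, hR, hbd⟩ := jacobiPoly_bound hb
  have hRg : GeomBounded fun j => R ^ j := ⟨1, R, hR, fun j => by
    rw [one_mul, abs_of_nonneg (by positivity)]⟩
  refine ⟨fun j => |modeWeight b j * a j * R ^ j|,
    ((ha.geomBounded_mul (modeWeight_geomBounded hb)).mul_geomBounded hRg).summable.abs, ?_⟩
  intro l hl j s hs
  have h := hbd j s (abs_le.mpr ⟨hs.1.le, hs.2.le⟩)
  simp only
  rw [norm_mul, Real.norm_eq_abs, abs_mul _ (R ^ j), abs_of_nonneg (by positivity : 0 ≤ R ^ j)]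
  refine mul_le_mul_of_nonneg_left ?_ (abs_nonneg _)
  interval_cases l
  · exact h.1
  · exact h.2.1
  · exact h.2.2

theorem jacobiSeries_hasSum {b : ℝ} (hb : 1 / 2 ≤ b) {a : ℕ → ℝ} (ha : RapidDecay a) {l : ℕ}
    (hl : l ≤ 2) {s : ℝ} (hs : s ∈ Set.Ioo (-2 : ℝ) 2) :
    HasSum (fun j => modeWeight b j * a j * (derivative^[l] (jacobiPoly b j)).eval s)
      (jacobiSeries b a l s) := by
  obtain ⟨u, hu, hub⟩ := jacobiSeries_bound hb ha
  exact (Summable.of_norm_bounded hu fun j => hub l hl j s hs).hasSum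

theorem jacobiSeries_hasDerivAt {b : ℝ} (hb : 1 / 2 ≤ b) {a : ℕ → ℝ} (ha : RapidDecay a) {l : ℕ}
    (hl : l ≤ 1) {s : ℝ} (hs : s ∈ Set.Ioo (-2 : ℝ) 2) :
    HasDerivAt (jacobiSeries b a l) (jacobiSeries b a (l + 1) s) s := by
  obtain ⟨u, hu, hub⟩ := jacobiSeries_bound hb ha
  refine hasDerivAt_tsum_of_isPreconnected
    (g := fun j s => modeWeight b j * a j * (derivative^[l] (jacobiPoly b j)).eval s)
    (g' := fun j s => modeWeight b j * a j * (derivative^[l + 1] (jacobiPoly b j)).eval s)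
    hu isOpen_Ioo isPreconnected_Ioo (fun j y _ => ?_)
    (fun j y hy => hub (l + 1) (by omega) j y hy) hs
    (jacobiSeries_hasSum hb ha (by omega) hs).summable hs
  rw [Function.iterate_succ_apply']
  exact ((derivative^[l] (jacobiPoly b j)).hasDerivAt y).const_mul _

theorem jacobiSeries_continuousOn {b : ℝ} (hb : 1 / 2 ≤ b) {a : ℕ → ℝ} (ha : RapidDecay a) {l : ℕ}
    (hl : l ≤ 2) : ContinuousOn (jacobiSeries b a l) (Set.Ioo (-2) 2) := by
  obtain ⟨u, hu, hub⟩ := jacobiSeries_bound hb ha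
  exact continuousOn_tsum (fun j => by fun_prop) hu fun j s hs => hub l hl j s hs

theorem jacobiSeries_contDiffOn {b : ℝ} (hb : 1 / 2 ≤ b) {a : ℕ → ℝ} (ha : RapidDecay a) :
    ContDiffOn ℝ 2 (jacobiSeries b a 0) (Set.Ioo (-2) 2) := by
  have hd : ∀ l ≤ 1, DifferentiableOn ℝ (jacobiSeries b a l) (Set.Ioo (-2) 2) := fun l hl s hs =>
    (jacobiSeries_hasDerivAt hb ha hl hs).differentiableAt.differentiableWithinAt
  have hd' : ∀ l ≤ 1, Set.EqOn (deriv (jacobiSeries b a l)) (jacobiSeries b a (l + 1))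
      (Set.Ioo (-2) 2) := fun l hl s hs => (jacobiSeries_hasDerivAt hb ha hl hs).deriv
  have h1 : ContDiffOn ℝ 1 (jacobiSeries b a 1) (Set.Ioo (-2) 2) := by
    rw [show (1 : WithTop ℕ∞) = 0 + 1 by norm_num, contDiffOn_succ_iff_deriv_of_isOpen isOpen_Ioo]
    refine ⟨hd 1 le_rfl, by simp, ?_⟩
    rw [contDiffOn_zero]
    exact (jacobiSeries_continuousOn hb ha le_rfl).congr (hd' 1 le_rfl)
  rw [show (2 : WithTop ℕ∞) = 1 + 1 by norm_num, contDiffOn_succ_iff_deriv_of_isOpen isOpen_Ioo]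
  exact ⟨hd 0 zero_le_one, by simp, h1.congr (hd' 0 zero_le_one)⟩

theorem jacobiPoly_geomBounded {b : ℝ} (hb : 1 / 2 ≤ b) {s : ℝ} (hs : s ∈ Set.Ioo (-2 : ℝ) 2) :
    GeomBounded fun j => (jacobiPoly b j).eval s := by
  obtain ⟨R, hR, hbd⟩ := jacobiPoly_bound hb
  exact ⟨1, R, hR, fun j => by
    rw [one_mul]; exact (hbd j s (abs_le.mpr ⟨hs.1.le, hs.2.le⟩)).1⟩

/-- The Jacobi series of a rapidly decaying solution of the recurrence solves the radial
equation. -/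
theorem jacobiSeries_ode {b g lam : ℝ} (hb : 1 / 2 ≤ b) {a : ℕ → ℝ} (ha : RapidDecay a)
    (hmode : IsModeSeq b g lam a) {s : ℝ} (hs : s ∈ Set.Ioo (-2 : ℝ) 2) :
    4 * b * s * jacobiSeries b a 1 s
      - 4 * (1 - s) * (jacobiSeries b a 1 s + s * jacobiSeries b a 2 s)
      + g * (1 - s) * jacobiSeries b a 0 s = lam * jacobiSeries b a 0 s := by
  have h0 := jacobiSeries_hasSum hb ha (l := 0) (by norm_num) hs
  have h1 := jacobiSeries_hasSum hb ha (l := 1) (by norm_num) hs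
  have h2 := jacobiSeries_hasSum hb ha (l := 2) (by norm_num) hs
  have hsum := ((h1.mul_left (4 * b * s)).sub
    ((h1.add (h2.mul_left s)).mul_left (4 * (1 - s)))).add (h0.mul_left (g * (1 - s) - lam))
  set p : ℕ → ℝ := fun j => (jacobiPoly b j).eval s with hp
  have hterm : ∀ j, 4 * b * s * (modeWeight b j * a j * (derivative^[1] (jacobiPoly b j)).eval s)
      - 4 * (1 - s) * (modeWeight b j * a j * (derivative^[1] (jacobiPoly b j)).eval s
        + s * (modeWeight b j * a j * (derivative^[2] (jacobiPoly b j)).eval s))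
      + (g * (1 - s) - lam) * (modeWeight b j * a j * (derivative^[0] (jacobiPoly b j)).eval s)
      = -g * (a j * jacobiDiff b p j - p j * jacobiDiff b a j) := by
    intro j
    have e := congrArg (eval s) (jacobiPoly_ode b j)
    simp only [eval_sub, eval_mul, eval_C, eval_X, eval_one, derivative_mul, derivative_X,
      eval_add, one_mul] at e
    have e2 : jacobiDiff b p j = modeWeight b j * (s * p j) := jacobiDiff_eval' hb j s
    rw [e2]
    simp only [Function.iterate_succ, Function.iterate_zero, Function.comp_apply, id, hp]
    linear_combination modeWeight b j * a j * e + (jacobiPoly b j).eval s * hmode j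
  simp only [hterm] at hsum
  have ht := hsum.tendsto_sum_nat.comp (tendsto_add_atTop_nat 1)
  have hk := tendsto_kappa_mul hb ha (jacobiPoly_geomBounded hb hs)
  have hlim := (hk.1.sub hk.2).const_mul (-g)
  simp only [sub_zero, mul_zero] at hlim
  have := tendsto_nhds_unique ht (hlim.congr fun n => ?_)
  · linear_combination this
  · rw [Function.comp_apply, ← Finset.mul_sum, jacobiDiff_green, Nat.add_sub_cancel]
    simp only [hp]; ring

/-- The Jacobi polynomials themselves solve the radial equation with `γ = 0`. -/
theorem isRadialSolution_jacobiPoly (k m i : ℕ) :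
    IsRadialSolution k m 0 (freeEigenvalue (k + m / 2) i)
      (fun r => r ^ k * (jacobiPoly (k + m / 2) i).eval (1 - r ^ 2))
      (fun r => k * r ^ (k - 1) * (jacobiPoly (k + m / 2) i).eval (1 - r ^ 2)
        + r ^ k * ((derivative (jacobiPoly (k + m / 2) i)).eval (1 - r ^ 2) * -(2 * r)))
      (fun t => (jacobiPoly (k + m / 2) i).eval (1 - t)) := by
  set p := jacobiPoly (k + m / 2) i with hp
  have hcomp : ∀ (q : ℝ[X]) (t : ℝ),
      HasDerivAt (fun t => q.eval (1 - t)) (-(derivative q).eval (1 - t)) t := by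
    intro q t
    have h := HasDerivAt.comp (h₂ := fun s => q.eval s) (h := fun t : ℝ => 1 - t) t
      (q.hasDerivAt (1 - t)) ((hasDerivAt_id t).const_sub 1)
    rw [mul_neg_one] at h
    exact h
  refine ⟨by fun_prop, by fun_prop, fun r _ => rfl, fun r _ =>
    (hasDerivAt_pow k r).mul (hasDerivAt_eval_one_sub_sq p r), fun hk => by simp [hk],
    fun hk => by simp [hk], fun t => -(derivative p).eval (1 - t),
    fun t => (derivative (derivative p)).eval (1 - t), fun t _ => ⟨hcomp p t, ?_, ?_⟩⟩
  · simpa using (hcomp (derivative p) t).fun_neg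
  · have e := congrArg (eval (1 - t)) (jacobiPoly_ode (k + m / 2 : ℝ) i)
    rw [← hp] at e
    simp only [eval_sub, eval_mul, eval_C, eval_X, eval_one, derivative_mul, derivative_X,
      eval_add, one_mul] at e
    linear_combination e

/-- Uniqueness of Jacobi series, by orthogonality of the Jacobi polynomials. -/
theorem eq_zero_of_jacobiSeries {m : ℕ} (hm : 1 ≤ m) (k : ℕ) {a : ℕ → ℝ} (ha : RapidDecay a)
    (h : ∀ r ∈ Set.Ioo (0 : ℝ) 1, jacobiSeries (k + m / 2) a 0 (1 - r ^ 2) = 0) (i : ℕ) :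
    a i = 0 := by
  have hb := half_le_index hm k
  set b : ℝ := k + m / 2 with hbdef
  set f : ℝ → ℝ := fun r => r ^ (k + m - 1) * (r ^ k * (jacobiPoly b i).eval (1 - r ^ 2)) with hf
  have hfc : Continuous f := by fun_prop
  have hmode : IsModeSeq b 0 (freeEigenvalue b i) (jacobiIntegral b f) :=
    (isRadialSolution_jacobiPoly k m i).isModeSeq hm hb
  have horth : ∀ j, j ≠ i → jacobiIntegral b f j = 0 := by
    intro j hj
    have h1 := hmode j
    rw [zero_mul, add_zero] at h1
    have h2 := (freeEigenvalue_strictMono hb).injective.ne hj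
    exact (mul_eq_zero.mp h1).resolve_left
      (mul_ne_zero (modeWeight_pos hb j).ne' (sub_ne_zero.mpr h2))
  have hpos : 0 < jacobiIntegral b f i := by
    refine intervalIntegral.integral_pos zero_lt_one (by fun_prop) (fun r hr => ?_)
      ⟨1, by norm_num, ?_⟩
    · have := hr.1.le
      have h1 : f r * (jacobiPoly b i).eval (1 - r ^ 2)
          = r ^ (k + m - 1) * r ^ k * (jacobiPoly b i).eval (1 - r ^ 2) ^ 2 := by
        simp only [hf]; ring
      rw [h1]; positivity
    · have h1 : (jacobiPoly b i).eval 0 = 1 := by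
        rw [← coeff_zero_eq_eval_zero, jacobiPoly_coeff, jacobiCoeff]
      simp [hf, h1]
  obtain ⟨u, hu, hub⟩ := jacobiSeries_bound hb ha
  obtain ⟨K, hK⟩ := (isCompact_Icc (a := (0 : ℝ)) (b := 1)).exists_bound_of_continuousOn
    hfc.continuousOn
  have hIoo : ∀ r ∈ Set.Ioc (0 : ℝ) 1, 1 - r ^ 2 ∈ Set.Ioo (-2 : ℝ) 2 := fun r hr => by
    constructor <;> nlinarith [hr.1, hr.2]
  have hsum : HasSum (fun j => ∫ r in (0 : ℝ)..1,
      f r * (modeWeight b j * a j * (jacobiPoly b j).eval (1 - r ^ 2)))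
      (∫ r in (0 : ℝ)..1, f r * jacobiSeries b a 0 (1 - r ^ 2)) := by
    refine intervalIntegral.hasSum_integral_of_dominated_convergence (fun j _ => K * u j)
      (fun j => ?_) (fun j => ?_) ?_ ?_ ?_
    · exact Continuous.aestronglyMeasurable (by fun_prop)
    · refine Eventually.of_forall fun r hr => ?_
      rw [Set.uIoc_of_le zero_le_one] at hr
      have h1 := hK r ⟨hr.1.le, hr.2⟩
      rw [norm_mul]
      have h2 := hub 0 (by norm_num) j _ (hIoo r hr)
      simp only [Function.iterate_zero, id] at h2
      exact mul_le_mul h1 h2 (norm_nonneg _)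
        ((norm_nonneg _).trans h1)
    · exact Eventually.of_forall fun r _ => hu.mul_left K
    · exact intervalIntegrable_const
    · refine Eventually.of_forall fun r hr => ?_
      rw [Set.uIoc_of_le zero_le_one] at hr
      have h1 := (jacobiSeries_hasSum hb ha (l := 0) (by norm_num) (hIoo r hr)).mul_left (f r)
      simpa only [Function.iterate_zero, id] using h1
  have hzero : ∫ r in (0 : ℝ)..1, f r * jacobiSeries b a 0 (1 - r ^ 2) = 0 := by
    rw [intervalIntegral.integral_of_le zero_le_one, MeasureTheory.integral_Ioc_eq_integral_Ioo]
    refine MeasureTheory.setIntegral_eq_zero_of_forall_eq_zero fun r hr => ?_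
    rw [h r hr, mul_zero]
  have hterm : ∀ j, ∫ r in (0 : ℝ)..1,
      f r * (modeWeight b j * a j * (jacobiPoly b j).eval (1 - r ^ 2))
      = modeWeight b j * a j * jacobiIntegral b f j := by
    intro j
    rw [jacobiIntegral, ← intervalIntegral.integral_const_mul]
    congr 1; ext r; ring
  rw [hzero] at hsum
  simp only [hterm] at hsum
  have h1 := hsum.unique (hasSum_single i fun j hj => by rw [horth j hj, mul_zero])
  have h2 := (mul_eq_zero.mp h1.symm).resolve_right hpos.ne'
  exact (mul_eq_zero.mp h2).resolve_left (modeWeight_pos hb i).ne'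

/-- Every rapidly decaying solution of the recurrence gives an even wave function. -/
theorem IsModeSeq.isEvenCPSWF {m k : ℕ} (hm : 1 ≤ m) {Y : RSpace m → Cl m}
    (hY : IsSphericalMonogenic k Y) (hY0 : Y ≠ 0) {c χ : ℝ} {a : ℕ → ℝ} (ha0 : a ≠ 0)
    (ha : RapidDecay a) (hmode : IsModeSeq (k + m / 2) (4 * Real.pi ^ 2 * c ^ 2) χ a) :
    χ ∈ evenEigenvalues Y c := by
  have hb := half_le_index hm k
  set b : ℝ := k + m / 2 with hbdef
  set P : ℝ → ℝ := fun t => jacobiSeries b a 0 (1 - t) with hP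
  have hIoo : ∀ x ∈ Metric.closedBall (0 : RSpace m) 1, 1 - ‖x‖ ^ 2 ∈ Set.Ioo (-2 : ℝ) 2 := by
    intro x hx
    have h1 : ‖x‖ ≤ 1 := by simpa using hx
    have h2 := norm_nonneg x
    constructor <;> nlinarith
  have hd : ∀ l ≤ 1, ∀ t, 1 - t ∈ Set.Ioo (-2 : ℝ) 2 → HasDerivAt
      (fun t => jacobiSeries b a l (1 - t)) (-jacobiSeries b a (l + 1) (1 - t)) t := by
    intro l hl t ht
    have h := HasDerivAt.comp (h₂ := jacobiSeries b a l) (h := fun t : ℝ => 1 - t) t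
      (jacobiSeries_hasDerivAt hb ha hl ht) ((hasDerivAt_id t).const_sub 1)
    rw [mul_neg_one] at h
    exact h
  refine ⟨fun x => P (‖x‖ ^ 2) • Y x, ⟨P, fun x _ => rfl⟩, ?_, ?_, ?_⟩
  · refine ContDiffOn.fun_smul ?_ hY.1.contDiff.contDiffOn
    exact (jacobiSeries_contDiffOn hb ha).comp
      (contDiff_const.sub (contDiff_norm_sq ℝ)).contDiffOn hIoo
  · by_contra! hz
    obtain ⟨x₀, hx₀, hYx₀⟩ := hY.1.exists_unit hm hY0
    refine ha0 (funext fun i => eq_zero_of_jacobiSeries hm k ha (fun r hr => ?_) i)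
    have hn : ‖r • x₀‖ = r := by
      rw [norm_smul, hx₀, mul_one, Real.norm_eq_abs, abs_of_pos hr.1]
    have h1 := hz (r • x₀) (by rw [mem_closedBall_zero_iff, hn]; exact hr.2.le)
    rw [hn, hY.1.smul_apply] at h1
    exact (smul_eq_zero.mp h1).resolve_right (smul_ne_zero (pow_ne_zero _ hr.1.ne') hYx₀)
  · intro x hx
    have hx' := hIoo x (Metric.ball_subset_closedBall hx)
    have hev : ∀ᶠ y in 𝓝 x, 1 - ‖y‖ ^ 2 ∈ Set.Ioo (-2 : ℝ) 2 := by
      filter_upwards [Metric.isOpen_ball.mem_nhds hx] with y hy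
        using hIoo y (Metric.ball_subset_closedBall hy)
    have h2 : HasDerivAt (fun t => -jacobiSeries b a 1 (1 - t))
        (jacobiSeries b a 2 (1 - ‖x‖ ^ 2)) (‖x‖ ^ 2) := by
      simpa using (hd 1 le_rfl _ hx').fun_neg
    rw [cliffordL_radial hY c (P := P) (P₁ := fun t => -jacobiSeries b a 1 (1 - t))
      (Eventually.of_forall fun y => rfl) (hev.mono fun y hy => hd 0 zero_le_one _ hy) h2,
      smul_smul]
    congr 1
    have h3 := jacobiSeries_ode hb ha hmode hx'
    rw [hbdef] at *
    simp only [hP]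
    linear_combination h3

/-- The eigenvalues are the parameters for which the recurrence has a nonzero rapidly decaying
solution. -/
theorem mem_evenEigenvalues_iff {m k : ℕ} (hm : 1 ≤ m) {Y : RSpace m → Cl m}
    (hY : IsSphericalMonogenic k Y) (hY0 : Y ≠ 0) {c : ℝ} (hc : 0 < c) (χ : ℝ) :
    χ ∈ evenEigenvalues Y c ↔
      ∃ a : ℕ → ℝ, a ≠ 0 ∧ RapidDecay a ∧ IsModeSeq (k + m / 2) (4 * Real.pi ^ 2 * c ^ 2) χ a :=
  ⟨fun ⟨_, h⟩ => h.exists_isModeSeq hm hY hc,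
    fun ⟨_, ha0, ha, hmode⟩ => hmode.isEvenCPSWF hm hY hY0 ha0 ha⟩

/-! ### Counting eigenvalues -/

/-- Bounds on the number of points below two thresholds locate the points in increasing order. -/
theorem exists_and_bounds_of_counting {S : Set ℝ} {d : ℕ → ℝ} {g : ℝ} {N : ℕ} (hg : 0 < g)
    (hd : Tendsto d atTop atTop)
    (hlo : ∀ n, ∀ s : Finset ℝ, (∀ x ∈ s, x ≤ d n ∧ x ∈ S) → s.card ≤ n)
    (hup : ∃ s : Finset ℝ, s.card = N + 1 ∧ ∀ x ∈ s, x ≤ d N + g ∧ x ∈ S) :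
    (∃ χ ∈ S, {x | x ∈ S ∧ x < χ}.encard = (N : ℕ∞)) ∧
      ∀ χ ∈ S, {x | x ∈ S ∧ x < χ}.encard = (N : ℕ∞) → d N < χ ∧ χ < d N + 2 * g := by
  obtain ⟨s, hs, hsS⟩ := hup
  have hfin : ∀ y : ℝ, {x | x ∈ S ∧ x < y}.Finite := by
    intro y
    obtain ⟨n, hn⟩ := (hd.eventually_ge_atTop y).exists
    by_contra hinf
    obtain ⟨t, htS, htc⟩ := Set.Infinite.exists_subset_card_eq hinf (n + 1)
    have := hlo n t fun x hx => ⟨((htS hx).2.le).trans hn, (htS hx).1⟩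
    omega
  refine ⟨?_, fun χ hχ hcard => ⟨?_, ?_⟩⟩
  · -- the eigenvalue with index `N` in the increasing enumeration of those up to `d N + g`
    set F : Finset ℝ := (hfin (d N + 2 * g)).toFinset with hF
    have hsF : s ⊆ F := fun x hx => by
      rw [hF, Set.Finite.mem_toFinset]
      exact ⟨(hsS x hx).2, by linarith [(hsS x hx).1]⟩
    have hFc : N < F.card := by
      have := Finset.card_le_card hsF
      omega
    let e := F.orderEmbOfFin rfl
    have heF : ∀ i, e i ∈ F := fun i => Finset.orderEmbOfFin_mem F rfl i
    have hmem : e ⟨N, hFc⟩ ∈ S ∧ e ⟨N, hFc⟩ < d N + 2 * g := by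
      simpa [hF] using heF ⟨N, hFc⟩
    refine ⟨e ⟨N, hFc⟩, hmem.1, ?_⟩
    have hset : {x | x ∈ S ∧ x < e ⟨N, hFc⟩}
        = e '' (Set.Iio (⟨N, hFc⟩ : Fin F.card)) := by
      ext x
      constructor
      · rintro ⟨hxS, hx⟩
        have hxF : x ∈ F := by
          rw [hF, Set.Finite.mem_toFinset]; exact ⟨hxS, hx.trans hmem.2⟩
        have hr : x ∈ Set.range e := by
          rw [Finset.range_orderEmbOfFin]; exact hxF
        obtain ⟨i, rfl⟩ := hr
        exact ⟨i, e.lt_iff_lt.mp hx, rfl⟩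
      · rintro ⟨i, hi, rfl⟩
        have h1 : e i ∈ S ∧ e i < d N + 2 * g := by simpa [hF] using heF i
        exact ⟨h1.1, e.lt_iff_lt.mpr hi⟩
    rw [hset, e.injective.encard_image, ← Finset.coe_Iio, Set.encard_coe_eq_coe_finsetCard,
      Fin.card_Iio]
  · by_contra! hle
    set t : Finset ℝ := (hfin χ).toFinset with ht
    have htc : t.card = N := by
      rw [(hfin χ).encard_eq_coe_toFinset_card] at hcard
      exact_mod_cast hcard
    have hnot : χ ∉ t := by simp [ht]
    have := hlo N (insert χ t) fun x hx => by
      rw [Finset.mem_insert, ht, Set.Finite.mem_toFinset] at hx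
      rcases hx with rfl | hx
      · exact ⟨hle, hχ⟩
      · exact ⟨hx.2.le.trans hle, hx.1⟩
    rw [Finset.card_insert_of_notMem hnot, htc] at this
    omega
  · by_contra! hle
    have hsub : (s : Set ℝ) ⊆ {x | x ∈ S ∧ x < χ} := fun x hx =>
      ⟨(hsS x hx).2, by linarith [(hsS x hx).1]⟩
    have := Set.encard_le_encard hsub
    rw [hcard, Set.encard_coe_eq_coe_finsetCard, hs] at this
    have h2 : N + 1 ≤ N := by exact_mod_cast this
    omega

theorem mainTheorem4 (m k n : ℕ) (hm : 1 ≤ m) (hn : Even n) (c : ℝ) (hc : 0 < c)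
    (Y : RSpace m → Cl m) (hY : IsSphericalMonogenic k Y) (hY0 : Y ≠ 0) :
    (∃ χ : ℝ, IsCPSWFEigenvalue Y c n χ) ∧
      ∀ χ : ℝ, IsCPSWFEigenvalue Y c n χ →
        (n : ℝ) * (n + 2 * k + m) < χ ∧
          χ < (n : ℝ) * (n + 2 * k + m) + 8 * Real.pi ^ 2 * c ^ 2 := by
  obtain ⟨N, rfl⟩ := hn
  have hN : (N + N) / 2 = N := by omega
  have hb := half_le_index hm k
  have hg : 0 < 4 * Real.pi ^ 2 * c ^ 2 := by positivity
  have hd : Tendsto (freeEigenvalue (k + m / 2 : ℝ)) atTop atTop :=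
    tendsto_atTop_mono (freeEigenvalue_ge hb)
      ((tendsto_pow_atTop two_ne_zero).comp tendsto_natCast_atTop_atTop)
  have hmem := mem_evenEigenvalues_iff hm hY hY0 hc
  obtain ⟨h1, h2⟩ := exists_and_bounds_of_counting (S := evenEigenvalues Y c) (N := N) hg hd
    (fun n s hs => card_modes_le hb hg n s fun x hx => ⟨(hs x hx).1, (hmem x).mp (hs x hx).2⟩)
    (by
      obtain ⟨s, hs, hsS⟩ := exists_modes hb hg N
      exact ⟨s, hs, fun x hx => ⟨(hsS x hx).1, (hmem x).mpr (hsS x hx).2⟩⟩)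
  have hdN : freeEigenvalue (k + m / 2 : ℝ) N
      = ((N + N : ℕ) : ℝ) * ((N + N : ℕ) + 2 * k + m) := by
    rw [freeEigenvalue]; push_cast; ring
  unfold IsCPSWFEigenvalue
  rw [hN, ← hdN]
  refine ⟨h1, fun χ hχ => ?_⟩
  obtain ⟨h3, h4⟩ := h2 χ hχ.1 hχ.2
  exact ⟨h3, by linarith⟩

end
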